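/- Let $d\ge 1$, let $\Omega'\subset\mathbb R^d$ be a nonempty bounded open set with smooth boundary, and let $(\mu_k^2)_{k\ge 1}$ be the nondecreasing sequence of the eigenvalues, counted with multiplicity, of the Dirichlet Laplacian $-\Delta$ on $L^2(\Omega')$ with domain $H^2(\Omega')\cap H^1_0(\Omega')$. Let $H>0$ and let $c\in L^\infty(0,H)$ satisfy $0<c_m:=\operatorname{ess\,inf}c<\operatorname{ess\,sup}c$. Suppose that $c$ has a well: there are $0\le\alpha<\beta\le H$ and $c_1>c_m$ such that $c(y)\ge c_1$ for a.e. $y\in(0,H)\setminus(\alpha,\beta)$. For $k\ge 1$ let $A_k=c(y)\big(\mu_k^2-\frac{d^2}{dy^2}\big)$ in $L^2((0,H),c(y)^{-1}dy)$ with domain $H^2(0,H)\cap H^1_0(0,H)$, and let $\beta_{k,1}$ be its smallest eigenvalue. Then the number of eigenvalues $\lambda$ of $A_k$ that satisfy $$\xi_{\lambda,k}^2:=2\Big(\mu_k^2-\frac{\lambda}{c_1}\Big)>0$$ is finite for all sufficiently large $k$ and tends to infinity as $k\to\infty$. In particular, there are $\varepsilon_0>0$ and $K$ such that for all $k>K$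 $$\beta_{k,1}<(c_1-\varepsilon_0)\,\mu_k^2 .$$ -/

import Mathlib

open MeasureTheory Filter Topology Set
open scoped ContDiff

/-! ### Sobolev spaces through weak derivatives -/

/-- `φ` belongs to `C_c^∞(U)`. -/
def IsTestFn {E : Type*} [NormedAddCommGroup E] [NormedSpace ℝ E]
    (U : Set E) (φ : E → ℝ) : Prop :=
  ContDiff ℝ ∞ φ ∧ HasCompactSupport φ ∧ tsupport φ ⊆ U

/-- `g` is the weak derivative of `u` on the open set `U` in the direction `v`. -/
def HasWeakDirDeriv {E : Type*} [NormedAddCommGroup E] [NormedSpace ℝ E] [MeasureSpace E]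
    (U : Set E) (v : E) (u g : E → ℝ) : Prop :=
  LocallyIntegrableOn u U ∧ LocallyIntegrableOn g U ∧
    ∀ φ : E → ℝ, IsTestFn U φ →
      ∫ x in U, u x * fderiv ℝ φ x v = - ∫ x in U, g x * φ x

/-- `u ∈ L²(U)`. -/
def IsL2 {E : Type*} [NormedAddCommGroup E] [MeasureSpace E]
    (U : Set E) (u : E → ℝ) : Prop :=
  MemLp u 2 (volume.restrict U)

/-- `u ∈ H²(U)`: `u` and all its weak derivatives of orders one and two are in `L²(U)`. -/
def IsH2 {E : Type*} [NormedAddCommGroup E] [NormedSpace ℝ E] [MeasureSpace E]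
    (U : Set E) (u : E → ℝ) : Prop :=
  IsL2 U u ∧ ∀ v : E, ∃ g : E → ℝ, HasWeakDirDeriv U v u g ∧ IsL2 U g ∧
    ∀ w : E, ∃ h : E → ℝ, HasWeakDirDeriv U w g h ∧ IsL2 U h

/-- `u ∈ H¹₀(U)`: `u` is the limit in `H¹(U)` of a sequence of elements of `C_c^∞(U)`. -/
def IsH10 {E : Type*} [NormedAddCommGroup E] [NormedSpace ℝ E] [MeasureSpace E]
    (U : Set E) (u : E → ℝ) : Prop :=
  IsL2 U u ∧ ∃ φ : ℕ → E → ℝ, (∀ n, IsTestFn U (φ n)) ∧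
    Tendsto (fun n => eLpNorm (fun x => u x - φ n x) 2 (volume.restrict U)) atTop (𝓝 0) ∧
    ∀ v : E, ∃ g : E → ℝ, HasWeakDirDeriv U v u g ∧ IsL2 U g ∧
      Tendsto (fun n => eLpNorm (fun x => g x - fderiv ℝ (φ n) x v) 2 (volume.restrict U))
        atTop (𝓝 0)

/-! ### The cross section and its Dirichlet eigenvalues -/

/-- A nonempty bounded open set with smooth boundary: near each boundary point the set is the
sublevel set of a smooth function with nonvanishing differential at that point. -/
structure IsSmoothBoundedOpen {d : ℕ} (Ω : Set (EuclideanSpace ℝ (Fin d))) : Prop where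
  isOpen : IsOpen Ω
  nonempty : Ω.Nonempty
  isBounded : Bornology.IsBounded Ω
  smooth_boundary : ∀ p ∈ frontier Ω, ∃ V : Set (EuclideanSpace ℝ (Fin d)),
    ∃ ρ : EuclideanSpace ℝ (Fin d) → ℝ, IsOpen V ∧ p ∈ V ∧ ContDiff ℝ ∞ ρ ∧
      fderiv ℝ ρ p ≠ 0 ∧ Ω ∩ V = {x | x ∈ V ∧ ρ x < 0}

/-- `u` lies in the domain `H²(Ω) ∩ H¹₀(Ω)` of the Dirichlet Laplacian and `-Δu = t u`. -/
def SolvesDirichletEigen {d : ℕ} (Ω : Set (EuclideanSpace ℝ (Fin d))) (t : ℝ)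
    (u : EuclideanSpace ℝ (Fin d) → ℝ) : Prop :=
  IsH2 Ω u ∧ IsH10 Ω u ∧ ∃ g h : Fin d → EuclideanSpace ℝ (Fin d) → ℝ,
    (∀ i, HasWeakDirDeriv Ω (EuclideanSpace.single i (1 : ℝ)) u (g i)) ∧
    (∀ i, HasWeakDirDeriv Ω (EuclideanSpace.single i (1 : ℝ)) (g i) (h i)) ∧
    ∀ᵐ x ∂(volume.restrict Ω), -(∑ i, h i x) = t * u x

/-- `(μ k ^ 2, φ k)` is the sequence of the eigenvalues of the Dirichlet Laplacian of `Ω`, in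
nondecreasing order and counted with multiplicity, with orthonormal eigenfunctions: those of the
`φ k` with `μ k ^ 2 = t` span the whole eigenspace of `t`, for each real `t`. -/
structure IsDirichletEigenSequence {d : ℕ} (Ω : Set (EuclideanSpace ℝ (Fin d)))
    (μ : ℕ → ℝ) (φ : ℕ → EuclideanSpace ℝ (Fin d) → ℝ) : Prop where
  mono : Monotone (fun k => μ k ^ 2)
  eigen : ∀ k, SolvesDirichletEigen Ω (μ k ^ 2) (φ k)
  orthonormal : ∀ j k, ∫ x in Ω, φ j x * φ k x = if j = k then 1 else 0
  exhaustive : ∀ (t : ℝ) (u : EuclideanSpace ℝ (Fin d) → ℝ), SolvesDirichletEigen Ω t u →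
    ∃ (s : Finset ℕ) (a : ℕ → ℝ), (∀ k ∈ s, μ k ^ 2 = t) ∧
      ∀ᵐ x ∂(volume.restrict Ω), u x = ∑ k ∈ s, a k * φ k x

/-! ### The diffusion coefficient, its wells, and the reduced operators -/

/-- `c ∈ L^∞(0,H)` and `0 < ess inf c < ess sup c`. -/
structure IsDiffusionCoeff (H : ℝ) (c : ℝ → ℝ) : Prop where
  memLp_top : MemLp c ⊤ (volume.restrict (Ioo 0 H))
  essInf_pos : 0 < essInf c (volume.restrict (Ioo 0 H))
  essInf_lt_essSup :
    essInf c (volume.restrict (Ioo 0 H)) < essSup c (volume.restrict (Ioo 0 H))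

/-- The layer over `(α, β) ⊆ (0, H)` is a well for the profile `c`, with threshold `c₁`. -/
structure IsWell (H : ℝ) (c : ℝ → ℝ) (α β c₁ : ℝ) : Prop where
  zero_le : 0 ≤ α
  lt : α < β
  le_height : β ≤ H
  essInf_lt : essInf c (volume.restrict (Ioo 0 H)) < c₁
  le_outside : ∀ᵐ y ∂(volume.restrict (Ioo 0 H \ Ioo α β)), c₁ ≤ c y

/-- `l` is an eigenvalue of the reduced operator `c(y) (m² - d²/dy²)` with domain
`H²(0,H) ∩ H¹₀(0,H)`. -/
def IsReducedEigenvalue (H : ℝ) (c : ℝ → ℝ) (m l : ℝ) : Prop :=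
  ∃ u p q : ℝ → ℝ, IsH2 (Ioo 0 H) u ∧ IsH10 (Ioo 0 H) u ∧
    ¬ (∀ᵐ y ∂(volume.restrict (Ioo 0 H)), u y = 0) ∧
    HasWeakDirDeriv (Ioo 0 H) 1 u p ∧ HasWeakDirDeriv (Ioo 0 H) 1 p q ∧
    ∀ᵐ y ∂(volume.restrict (Ioo 0 H)), c y * (m ^ 2 * u y - q y) = l * u y

/-- `ξ² = 2 (m² - l / c₁)`. -/
noncomputable def xiSq (c₁ m l : ℝ) : ℝ := 2 * (m ^ 2 - l / c₁)

/-! Fix c' > ess inf c and write m for μ_k. The equation c (m² u - u'') = l u is inverted. With R =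
(m² - d²/dy²)⁻¹ for Dirichlet conditions, the operator K = c^{-1/2} R c^{-1/2} is compact, symmetric
and positive on the unweighted space L²(0,H). Its positive eigenvalues are exactly the reciprocals
1/l (`exists_reduced_inverse`), so eigenvalues l < c' m² correspond to eigenvalues of K above (c'
m²)⁻¹. Compactness makes their number finite. By the min-max principle the number is at least n as
soon as the Rayleigh quotient of K exceeds (c' m²)⁻¹ on the combinations of n vectors
(`le_ncard_setOf_hasEigenvalue_gt`). Eigenvalues of K are simple, by uniqueness for the initial
value problem, so counting distinct eigenvalues loses nothing.

The trial vectors are v = c^{1/2} (m² u - u'') with u ∈ C_c^∞(0,H). For them ⟨Kv, v⟩ = ∫ u (m² u -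
u'') and ‖v‖² = ∫ c (m² u - u'')², so no regularity of c is needed. As m² → ∞, ⟨Kv, v⟩ - (c' m²)⁻¹
‖v‖² equals m² ∫ (1 - c/c') u² up to a bounded term, and it suffices that this integral be positive
(`eventually_testFn_rayleigh_lt`). Since {c < c'} has positive measure, it contains infinitely many
Lebesgue points of c. Bumps with disjoint supports near n of them give n trial functions without
cross terms (`eventually_finite_and_le_ncard`).

It remains to know that μ_k² → ∞ (`IsDirichletEigenSequence.tendsto_atTop`). If the sequence were
bounded, the orthonormal eigenfunctions would have bounded Dirichlet energy while tending weakly to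
0. On the Fourier side their mass at low frequencies then tends to 0 by dominated convergence, and
the energy makes their mass at high frequencies at most 1/2, against total mass 1. This takes the
place of Rellich's theorem.

The theorem follows with c' = c₁ for the count, and with n = 1 and c' strictly between ess inf c and
c₁ for the bound on the smallest eigenvalue. -/

/-! ### Compact positive operators -/

section CompactPositive

open Module.End

variable {E : Type*} [NormedAddCommGroup E] [InnerProductSpace ℝ E]

/-- A compact symmetric positive operator all of whose eigenvalues are at most `t` has norm at
most `t`. -/
theorem norm_le_of_forall_hasEigenvalue_le [CompleteSpace E] {T : E →L[ℝ] E} (hT : IsCompactOperator T)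
    (hsym : T.IsSymmetric) (hpos : ∀ x, 0 ≤ inner ℝ (T x) x) {t : ℝ} (ht : 0 ≤ t)
    (h : ∀ τ, HasEigenvalue (T : Module.End ℝ E) τ → τ ≤ t) : ‖T‖ ≤ t := by
  -- Self-adjointness makes the norm equal to the spectral radius, compactness makes every nonzero
  -- spectral value an eigenvalue, and positivity removes the absolute value.
  have h1 := T.spectralRadius_eq_nnnorm hsym.isSelfAdjoint
  have h2 : spectralRadius ℝ T ≤ (t.toNNReal : ENNReal) := by
    refine iSup₂_le fun τ hτ => ?_
    rw [ENNReal.coe_le_coe]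
    by_cases h0 : τ = 0
    · simp [h0]
    have hE := (hT.hasEigenvalue_iff_mem_spectrum h0).2 hτ
    have hn : 0 ≤ τ := by
      obtain ⟨x, hx⟩ := hE.exists_hasEigenvector
      have h3 := hpos x
      have h4 : T x = τ • x := hx.apply_eq_smul
      rw [h4, real_inner_smul_left] at h3
      have : 0 < inner ℝ x x := real_inner_self_pos.2 hx.2
      exact nonneg_of_mul_nonneg_left h3 this
    rw [← NNReal.coe_le_coe, coe_nnnorm, Real.norm_of_nonneg hn, Real.coe_toNNReal t ht]
    exact h τ hE
  rw [h1, ENNReal.coe_le_coe, ← NNReal.coe_le_coe, coe_nnnorm, Real.coe_toNNReal t ht] at h2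
  exact h2

/-- A compact symmetric operator has finitely many eigenvalues above a positive threshold. -/
theorem finite_setOf_hasEigenvalue_gt {T : E →L[ℝ] E} (hT : IsCompactOperator T)
    (hsym : T.IsSymmetric) {t : ℝ} (ht : 0 < t) :
    {τ : ℝ | HasEigenvalue (T : Module.End ℝ E) τ ∧ t < τ}.Finite := by
  have key : ∀ τ : {τ : ℝ | HasEigenvalue (T : Module.End ℝ E) τ ∧ t < τ},
      ∃ x : E, ‖x‖ = 1 ∧ T x = (τ : ℝ) • x := by
    rintro ⟨τ, hτ, -⟩
    obtain ⟨x, hx⟩ := hτ.exists_hasEigenvector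
    have hx0 : ‖x‖ ≠ 0 := norm_ne_zero_iff.2 hx.2
    refine ⟨‖x‖⁻¹ • x, by rw [norm_smul, norm_inv, norm_norm, inv_mul_cancel₀ hx0], ?_⟩
    have : T x = τ • x := hx.apply_eq_smul
    rw [map_smul, this, smul_comm]
  choose e he1 he2 using key
  have hort : ∀ σ τ, σ ≠ τ → inner ℝ (e σ) (e τ) = 0 := by
    intro σ τ hne
    have h1 : inner ℝ (T (e σ)) (e τ) = inner ℝ (e σ) (T (e τ)) := hsym _ _
    rw [he2, he2, real_inner_smul_left, real_inner_smul_right] at h1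
    have h2 : ((σ : ℝ) - τ) * inner ℝ (e σ) (e τ) = 0 := by linarith
    rcases mul_eq_zero.1 h2 with h | h
    · exact absurd (Subtype.ext (sub_eq_zero.1 h)) hne
    · exact h
  -- By orthogonality the squared distance is σ² + τ² > t². Infinitely many eigenvalues would
  -- therefore give a t-separated sequence in the image of the unit ball, which is relatively
  -- compact.
  have hdist : ∀ σ τ, σ ≠ τ → t ≤ dist (T (e σ)) (T (e τ)) := by
    intro σ τ hne
    rw [he2, he2, dist_eq_norm]
    have h1 : ‖(σ : ℝ) • e σ - (τ : ℝ) • e τ‖ ^ 2 = (σ : ℝ) ^ 2 + (τ : ℝ) ^ 2 := by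
      rw [norm_sub_sq_real, real_inner_smul_left, real_inner_smul_right, hort σ τ hne, norm_smul,
        norm_smul, he1, he1]
      simp
    have hσ : t < σ := σ.2.2
    refine le_of_sq_le_sq ?_ (norm_nonneg _)
    rw [h1]
    nlinarith [sq_nonneg (τ : ℝ)]
  have hcpt := hT.isCompact_closure_image_closedBall (𝕜₁ := ℝ) (f := (T : E →ₗ[ℝ] E)) 1
  by_contra hinf
  have hinf' : Infinite {τ : ℝ | HasEigenvalue (T : Module.End ℝ E) τ ∧ t < τ} :=
    Set.infinite_coe_iff.2 hinf
  obtain ⟨s⟩ : Nonempty (ℕ ↪ {τ : ℝ | HasEigenvalue (T : Module.End ℝ E) τ ∧ t < τ}) :=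
    ⟨Infinite.natEmbedding _⟩
  obtain ⟨y, -, ψ, hψ, hlim⟩ := hcpt.tendsto_subseq (x := fun n => T (e (s n)))
    (fun n => subset_closure ⟨e (s n), by simp [he1], rfl⟩)
  have hC := hlim.cauchySeq
  rw [Metric.cauchySeq_iff'] at hC
  obtain ⟨N, hN⟩ := hC t ht
  have h3 := hN (N + 1) (by omega)
  have h4 := hdist (s (ψ (N + 1))) (s (ψ N)) (fun h => by
    have := hψ.injective (s.injective h); omega)
  exact absurd h3 (not_lt.2 h4)

/-- Lower bound for the number of eigenvalues above `t` of a compact positive operator with simple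
eigenvalues, from vectors on whose span the Rayleigh quotient exceeds `t`. -/
theorem le_ncard_setOf_hasEigenvalue_gt [CompleteSpace E] {T : E →L[ℝ] E} (hT : IsCompactOperator T)
    (hsym : T.IsSymmetric) (hpos : ∀ x, 0 ≤ inner ℝ (T x) x) {t : ℝ} (ht : 0 < t)
    (hsimple : ∀ τ, t < τ → ∀ x y, T x = τ • x → T y = τ • y → x ≠ 0 → ∃ a : ℝ, y = a • x)
    {n : ℕ} (v : Fin n → E)
    (hv : ∀ a : Fin n → ℝ, a ≠ 0 →
      t * ‖∑ i, a i • v i‖ ^ 2 < inner ℝ (T (∑ i, a i • v i)) (∑ i, a i • v i)) :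
    n ≤ {τ : ℝ | HasEigenvalue (T : Module.End ℝ E) τ ∧ t < τ}.ncard := by
  set S := {τ : ℝ | HasEigenvalue (T : Module.End ℝ E) τ ∧ t < τ} with hS
  have hfin : S.Finite := finite_setOf_hasEigenvalue_gt hT hsym ht
  have : Fintype S := hfin.fintype
  by_contra hlt
  rw [not_le] at hlt
  have key : ∀ τ : S, ∃ x : E, x ≠ 0 ∧ T x = (τ : ℝ) • x := by
    rintro ⟨τ, hτ, -⟩
    obtain ⟨x, hx⟩ := hτ.exists_hasEigenvector
    exact ⟨x, hx.2, hx.apply_eq_smul⟩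
  choose e he0 he using key
  -- With fewer than n eigenvalues above t, some nonzero coefficient vector gives a combination x
  -- orthogonal to all the chosen eigenvectors. Should x itself vanish, the strict inequality `hv`
  -- already fails.
  let L : (Fin n → ℝ) →ₗ[ℝ] (S → ℝ) :=
    LinearMap.pi fun τ => (innerSL ℝ (e τ)).toLinearMap ∘ₗ Fintype.linearCombination ℝ v
  obtain ⟨a, ha, ha0⟩ : ∃ a ∈ LinearMap.ker L, a ≠ 0 := by
    refine Submodule.exists_mem_ne_zero_of_ne_bot fun hbot => ?_
    have := LinearMap.finrank_le_finrank_of_injective (LinearMap.ker_eq_bot.1 hbot)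
    rw [Module.finrank_fin_fun, Module.finrank_fintype_fun_eq_card, ← Nat.card_eq_fintype_card,
      Nat.card_coe_set_eq] at this
    omega
  set x := ∑ i, a i • v i with hx
  have hort : ∀ τ : S, inner ℝ (e τ) x = 0 := by
    intro τ
    have := congrFun (LinearMap.mem_ker.1 ha) τ
    simpa [L, Fintype.linearCombination_apply] using this
  let U : Submodule ℝ E := Submodule.span ℝ (Set.range e)
  have hxU : x ∈ Uᗮ := by
    rw [Submodule.mem_orthogonal]
    intro y hy
    induction hy using Submodule.span_induction with
    | mem y hy => obtain ⟨τ, rfl⟩ := hy; exact hort τ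
    | zero => simp
    | add y z _ _ h1 h2 => rw [inner_add_left, h1, h2, add_zero]
    | smul b y _ h1 => rw [real_inner_smul_left, h1, mul_zero]
  have hinv : ∀ y ∈ Uᗮ, T y ∈ Uᗮ := by
    intro y hy
    rw [Submodule.mem_orthogonal] at hy ⊢
    intro z hz
    have h1 : inner ℝ (T z) y = inner ℝ z (T y) := hsym z y
    rw [← h1]
    clear h1
    apply hy
    induction hz using Submodule.span_induction with
    | mem y hy =>
      obtain ⟨τ, rfl⟩ := hy
      rw [he]
      exact U.smul_mem _ (Submodule.subset_span ⟨τ, rfl⟩)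
    | zero => simp
    | add y z _ _ h1 h2 => rw [map_add]; exact U.add_mem h1 h2
    | smul b y _ h1 => rw [map_smul]; exact U.smul_mem _ h1
  let R : Uᗮ →L[ℝ] Uᗮ := T.restrict hinv
  have hR : IsCompactOperator R := hT.restrict' hinv
  have hRsym : R.IsSymmetric := hsym.restrict_invariant hinv
  -- By simplicity the span `U` contains every eigenvector with eigenvalue above t, so none is left
  -- on the orthogonal complement and the Rayleigh quotient there is at most t.
  have hRn : ‖R‖ ≤ t := by
    refine norm_le_of_forall_hasEigenvalue_le hR hRsym (fun y => hpos y) ht.le fun τ hτ => ?_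
    by_contra hlt'
    rw [not_le] at hlt'
    obtain ⟨y, hy⟩ := hτ.exists_hasEigenvector
    have h1 : R y = τ • y := hy.apply_eq_smul
    have h2 : T (y : E) = τ • (y : E) := congrArg Subtype.val h1
    have h3 : (y : E) ≠ 0 := fun h => hy.2 (Subtype.ext h)
    have h4 : HasEigenvalue (T : Module.End ℝ E) τ :=
      hasEigenvalue_of_hasEigenvector (x := (y : E)) ⟨mem_eigenspace_iff.2 h2, h3⟩
    obtain ⟨b, hb⟩ := hsimple τ hlt' _ _ (he ⟨τ, h4, hlt'⟩) h2 (he0 _)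
    have h5 : (y : E) ∈ U := by
      rw [hb]; exact U.smul_mem _ (Submodule.subset_span ⟨_, rfl⟩)
    exact h3 (by
      have := (Submodule.mem_orthogonal U (y : E)).1 y.2 _ h5
      exact inner_self_eq_zero.1 this)
  have h6 := hv a ha0
  have h7 : inner ℝ (T x) x = inner ℝ (R ⟨x, hxU⟩) ⟨x, hxU⟩ := rfl
  have h8 : inner ℝ (R ⟨x, hxU⟩) ⟨x, hxU⟩ ≤ t * ‖x‖ ^ 2 := by
    refine (real_inner_le_norm _ _).trans ?_
    have := R.le_opNorm ⟨x, hxU⟩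
    have h9 : ‖(⟨x, hxU⟩ : Uᗮ)‖ = ‖x‖ := rfl
    rw [h9] at this ⊢
    nlinarith [norm_nonneg x, mul_le_mul_of_nonneg_right hRn (norm_nonneg x)]
  linarith

end CompactPositive

/-! ### Primitives on an interval -/

section Primitive

variable {H : ℝ}

/-- Integration by parts for primitives of integrable functions. -/
theorem integral_mul_primitive_add_primitive_mul {p q : ℝ → ℝ}
    (hp : IntervalIntegrable p volume 0 H) (hq : IntervalIntegrable q volume 0 H) (a b : ℝ) :
    ∫ x in 0..H, (p x * (b + ∫ t in 0..x, q t) + (a + ∫ t in 0..x, p t) * q x) =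
      (a + ∫ t in 0..H, p t) * (b + ∫ t in 0..H, q t) - a * b := by
  -- The integrands are merely integrable, so the product rule is used for absolutely continuous
  -- functions, with derivatives only almost everywhere.
  have hac : ∀ (r : ℝ → ℝ) (k : ℝ), IntervalIntegrable r volume 0 H →
      AbsolutelyContinuousOnInterval (fun x => k + ∫ t in 0..x, r t) 0 H := fun r k hr =>
    (LipschitzOnWith.absolutelyContinuousOnInterval (K := 0)
      ((LipschitzWith.const k).lipschitzOnWith)).add
      (hr.absolutelyContinuousOnInterval_intervalIntegral left_mem_uIcc)
  have hd : ∀ (r : ℝ → ℝ) (k : ℝ), IntervalIntegrable r volume 0 H → ∀ᵐ x, x ∈ uIcc 0 H →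
      deriv (fun x => k + ∫ t in 0..x, r t) x = r x := fun r k hr => by
    filter_upwards [hr.ae_hasDerivAt_integral] with x hx hxm
    exact ((hx hxm 0 left_mem_uIcc).const_add k).deriv
  have := (hac p a hp).integral_deriv_mul_eq_sub (hac q b hq)
  simp only [intervalIntegral.integral_same, add_zero] at this
  rw [← this]
  apply intervalIntegral.integral_congr_ae
  filter_upwards [hd p a hp, hd q b hq] with x h1 h2 hx
  rw [h1 (uIoc_subset_uIcc hx), h2 (uIoc_subset_uIcc hx)]

theorem continuousOn_primitive' {p : ℝ → ℝ} (hp : IntervalIntegrable p volume 0 H) (a : ℝ) :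
    ContinuousOn (fun x => a + ∫ t in 0..x, p t) (uIcc 0 H) :=
  continuousOn_const.add (intervalIntegral.continuousOn_primitive_interval' hp left_mem_uIcc)

/-- Integration by parts for primitives of integrable functions, in two integrals. -/
theorem integral_primitive_mul {p q : ℝ → ℝ}
    (hp : IntervalIntegrable p volume 0 H) (hq : IntervalIntegrable q volume 0 H) (a b : ℝ) :
    ∫ x in 0..H, (a + ∫ t in 0..x, p t) * q x =
      (a + ∫ t in 0..H, p t) * (b + ∫ t in 0..H, q t) - a * b -
        ∫ x in 0..H, p x * (b + ∫ t in 0..x, q t) := by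
  rw [← integral_mul_primitive_add_primitive_mul hp hq a b, intervalIntegral.integral_add]
  · ring
  · exact hp.mul_continuousOn (continuousOn_primitive' hq b)
  · exact hq.continuousOn_mul (continuousOn_primitive' hp a)

/-- Uniqueness for the first order linear system `u' = p`, `p' = Q u` with bounded `Q` and zero
initial data. -/
theorem eq_zero_of_primitive_system (hH : 0 ≤ H) {u p Q : ℝ → ℝ} {C : ℝ}
    (hp : ContinuousOn p (Icc 0 H)) (hu : ∀ x ∈ Icc 0 H, u x = ∫ t in 0..x, p t)
    (hpu : ∀ x ∈ Icc 0 H, p x = ∫ t in 0..x, Q t * u t)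
    (hQ : ∀ᵐ x, x ∈ Ioo 0 H → |Q x| ≤ C) (hC : 0 ≤ C) :
    ∀ x ∈ Icc 0 H, u x = 0 := by
  have hpi : IntervalIntegrable p volume 0 H := by
    apply ContinuousOn.intervalIntegrable; rwa [uIcc_of_le hH]
  have huc : ContinuousOn u (Icc 0 H) := by
    have := continuousOn_primitive' hpi 0
    rw [uIcc_of_le hH] at this
    exact this.congr fun x hx => by simp [hu x hx]
  -- Grönwall's inequality is applied to Z(x) = ∫₀ˣ z, not to z, which need not be differentiable.
  -- The system gives Z' = z ≤ (1 + C) Z and Z(0) = 0.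
  set z : ℝ → ℝ := fun x => |u x| + |p x| with hz
  have hzc : ContinuousOn z (Icc 0 H) := huc.abs.add hp.abs
  have hzi : IntervalIntegrable z volume 0 H := by
    apply ContinuousOn.intervalIntegrable; rwa [uIcc_of_le hH]
  have hsub : ∀ {f : ℝ → ℝ} {x : ℝ}, x ∈ Icc 0 H → ContinuousOn f (Icc 0 H) →
      IntervalIntegrable f volume 0 x := fun {f x} hx hf => by
    apply ContinuousOn.intervalIntegrable
    rw [uIcc_of_le hx.1]; exact hf.mono (Icc_subset_Icc_right hx.2)
  have hle : ∀ x ∈ Icc 0 H, z x ≤ (1 + C) * ∫ t in 0..x, z t := by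
    intro x hx
    have h1 : |u x| ≤ ∫ t in 0..x, |p t| := by
      rw [hu x hx]; exact intervalIntegral.abs_integral_le_integral_abs hx.1
    have h2 : |p x| ≤ ∫ t in 0..x, C * |u t| := by
      rw [hpu x hx, ← Real.norm_eq_abs]
      refine intervalIntegral.norm_integral_le_of_norm_le hx.1 ?_ ((hsub hx huc.abs).const_mul C)
      have hne : ∀ᵐ t : ℝ, t ≠ H := by simp [ae_iff, measure_singleton]
      filter_upwards [hQ, hne] with t ht htH htx
      rw [norm_mul, Real.norm_eq_abs, Real.norm_eq_abs]
      exact mul_le_mul_of_nonneg_right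
        (ht ⟨htx.1, lt_of_le_of_ne (htx.2.trans hx.2) htH⟩) (abs_nonneg _)
    have h3 : ∫ t in 0..x, z t = (∫ t in 0..x, |u t|) + ∫ t in 0..x, |p t| :=
      intervalIntegral.integral_add (hsub hx huc.abs) (hsub hx hp.abs)
    have h4 : 0 ≤ ∫ t in 0..x, |u t| :=
      intervalIntegral.integral_nonneg hx.1 fun t _ => abs_nonneg _
    have h5 : 0 ≤ ∫ t in 0..x, |p t| :=
      intervalIntegral.integral_nonneg hx.1 fun t _ => abs_nonneg _
    rw [intervalIntegral.integral_const_mul] at h2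
    simp only [hz] at h3 ⊢
    rw [h3]
    nlinarith
  have hZ0 : ∀ x ∈ Icc 0 H, 0 ≤ ∫ t in 0..x, z t := fun x hx =>
    intervalIntegral.integral_nonneg hx.1 fun t _ => by positivity
  have hZc : ContinuousOn (fun x => ∫ t in 0..x, z t) (Icc 0 H) := by
    have := intervalIntegral.continuousOn_primitive_interval' hzi left_mem_uIcc
    rwa [uIcc_of_le hH] at this
  have hZd : ∀ x ∈ Ico 0 H,
      HasDerivWithinAt (fun x => ∫ t in 0..x, z t) (z x) (Ici x) x := by
    intro x hx
    have hxI : x ∈ Icc 0 H := Ico_subset_Icc_self hx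
    have hnhds : Icc 0 H ∈ 𝓝[>] x :=
      mem_of_superset (Ioc_mem_nhdsGT hx.2) fun y hy => ⟨hx.1.trans hy.1.le, hy.2⟩
    have hcw : ContinuousWithinAt z (Ioi x) x :=
      (hzc x hxI).mono_of_mem_nhdsWithin hnhds
    refine intervalIntegral.integral_hasDerivWithinAt_right (t := Ioi x) (hsub hxI hzc) ?_ hcw
    exact ⟨Icc 0 H, hnhds, hzc.aestronglyMeasurable measurableSet_Icc⟩
  have hgr := norm_le_gronwallBound_of_norm_deriv_right_le (δ := 0) (K := 1 + C) (ε := 0)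
    hZc hZd (by simp) (fun x hx => by
      have hxI : x ∈ Icc 0 H := Ico_subset_Icc_self hx
      rw [Real.norm_of_nonneg (by positivity), Real.norm_of_nonneg (hZ0 x hxI), add_zero]
      exact hle x hxI)
  intro x hx
  have h1 := hgr x hx
  rw [gronwallBound_ε0_δ0] at h1
  have h2 : ∫ t in 0..x, z t = 0 := norm_le_zero_iff.1 h1
  have h3 := hle x hx
  rw [h2, mul_zero] at h3
  have h4 : |u x| ≤ 0 := by
    have := abs_nonneg (p x)
    simp only [hz] at h3
    linarith
  exact abs_eq_zero.1 (le_antisymm h4 (abs_nonneg _))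

end Primitive

/-! ### The Volterra operator on `L²(0, H)` -/

section Volterra

/-- The Hilbert space `L²(0, H)`. -/
abbrev IntervalL2 (H : ℝ) : Type := Lp ℝ 2 (volume.restrict (Ioo 0 H))

variable {H : ℝ}

theorem Lp.intervalIntegrable_of_restrict_Ioo (hH : 0 ≤ H) {f : ℝ → ℝ}
    (hf : MemLp f 2 (volume.restrict (Ioo 0 H))) : IntervalIntegrable f volume 0 H := by
  rw [intervalIntegrable_iff_integrableOn_Ioo_of_le hH]
  exact hf.integrable one_le_two

theorem integral_Ioo_eq_intervalIntegral (hH : 0 ≤ H) (f : ℝ → ℝ) :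
    ∫ x in Ioo 0 H, f x = ∫ x in 0..H, f x := by
  rw [intervalIntegral.integral_of_le hH, integral_Ioc_eq_integral_Ioo]

theorem inner_eq_intervalIntegral (hH : 0 ≤ H) (f g : IntervalL2 H) :
    inner ℝ f g = ∫ x in 0..H, f x * g x := by
  rw [L2.inner_def, ← integral_Ioo_eq_intervalIntegral hH]
  refine integral_congr_ae (Eventually.of_forall fun x => ?_)
  simp [mul_comm]

/-- The indicator function of `(-∞, x]` in `L²(0, H)`. -/
noncomputable def cutAt (H x : ℝ) : IntervalL2 H :=
  indicatorConstLp 2 (s := Iic x) measurableSet_Iic (measure_ne_top _ _) 1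

/-- Values of the primitive become inner products, so estimates for the Volterra operator reduce to
estimates for `cutAt`. -/
theorem inner_cutAt (f : IntervalL2 H) {x : ℝ} (hx : x ∈ Icc 0 H) :
    inner ℝ (cutAt H x) f = ∫ t in 0..x, f t := by
  rw [cutAt, L2.inner_indicatorConstLp_one, Measure.restrict_restrict measurableSet_Iic,
    intervalIntegral.integral_of_le hx.1]
  rcases hx.2.eq_or_lt with h | h
  · rw [integral_Ioc_eq_integral_Ioo, h]
    congr 2
    ext y; constructor
    · exact fun hy => hy.2
    · exact fun hy => ⟨hy.2.le, hy⟩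
  · congr 2
    ext y; constructor
    · exact fun hy => ⟨hy.2.1, hy.1⟩
    · exact fun hy => ⟨hy.2, hy.1, hy.2.trans_lt h⟩

/-- The difference is the indicator of (x, y], whose L² norm is at most the square root of its
length. This Hölder modulus is what makes the Volterra operator compact. -/
theorem norm_cutAt_sub_le {x y : ℝ} (hxy : x ≤ y) :
    ‖cutAt H y - cutAt H x‖ ≤ √(y - x) := by
  have h1 : cutAt H y - cutAt H x = indicatorConstLp 2 (s := Ioc x y) (μ := volume.restrict (Ioo 0 H))
      measurableSet_Ioc (measure_ne_top _ _) (1 : ℝ) := by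
    apply Lp.ext
    have e1 := indicatorConstLp_coeFn (p := 2) (s := Iic x) (μ := volume.restrict (Ioo 0 H))
      (hs := measurableSet_Iic) (hμs := measure_ne_top _ _) (c := (1 : ℝ))
    have e2 := indicatorConstLp_coeFn (p := 2) (s := Iic y) (μ := volume.restrict (Ioo 0 H))
      (hs := measurableSet_Iic) (hμs := measure_ne_top _ _) (c := (1 : ℝ))
    have e3 := indicatorConstLp_coeFn (p := 2) (s := Ioc x y) (μ := volume.restrict (Ioo 0 H))
      (hs := measurableSet_Ioc) (hμs := measure_ne_top _ _) (c := (1 : ℝ))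
    filter_upwards [Lp.coeFn_sub (cutAt H y) (cutAt H x), e1, e2, e3] with t h0 h1 h2 h3
    rw [h0, h3, Pi.sub_apply, cutAt, cutAt, h1, h2]
    simp only [indicator, mem_Iic, mem_Ioc]
    by_cases hx : t ≤ x
    · simp [hx, hx.trans hxy, not_lt.2 hx]
    · simp [hx, not_le.1 hx]
  rw [h1]
  refine (norm_indicatorConstLp_le).trans ?_
  rw [norm_one, one_mul, Real.sqrt_eq_rpow]
  have h2 : (volume.restrict (Ioo 0 H)).real (Ioc x y) ≤ y - x := by
    rw [measureReal_def]
    refine ENNReal.toReal_le_of_le_ofReal (by linarith) ?_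
    exact (Measure.restrict_apply_le _ _).trans (by simp)
  have : (1 / (2 : ENNReal).toReal) = 1 / 2 := by simp
  rw [this]
  exact Real.rpow_le_rpow measureReal_nonneg h2 (by norm_num)

theorem continuous_cutAt : Continuous (cutAt H) := by
  rw [Metric.continuous_iff]
  intro x ε hε
  refine ⟨ε ^ 2, by positivity, fun y hy => ?_⟩
  have key : dist (cutAt H y) (cutAt H x) ≤ √(dist y x) := by
    rw [Real.dist_eq, dist_eq_norm]
    rcases le_total x y with h | h
    · rw [abs_of_nonneg (by linarith)]; exact norm_cutAt_sub_le h
    · rw [abs_of_nonpos (by linarith), norm_sub_rev, neg_sub]; exact norm_cutAt_sub_le h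
  refine key.trans_lt ?_
  rw [Real.sqrt_lt' hε]; exact hy

theorem norm_cutAt_le (hH : 0 ≤ H) (x : ℝ) : ‖cutAt H x‖ ≤ √H := by
  refine (norm_indicatorConstLp_le).trans ?_
  rw [norm_one, one_mul, Real.sqrt_eq_rpow]
  have h2 : (volume.restrict (Ioo 0 H)).real (Iic x) ≤ H := by
    rw [measureReal_def]
    refine ENNReal.toReal_le_of_le_ofReal hH ?_
    exact (measure_mono (subset_univ _)).trans (by simp)
  have : (1 / (2 : ENNReal).toReal) = 1 / 2 := by simp
  rw [this]
  exact Real.rpow_le_rpow measureReal_nonneg h2 (by norm_num)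

theorem memLp_inner_cutAt (hH : 0 ≤ H) (f : IntervalL2 H) :
    MemLp (fun x => inner ℝ (cutAt H x) f) 2 (volume.restrict (Ioo 0 H)) := by
  refine MemLp.of_bound (continuous_cutAt.inner continuous_const).aestronglyMeasurable
    (√H * ‖f‖) (Eventually.of_forall fun x => ?_)
  exact (norm_inner_le_norm _ _).trans
    (mul_le_mul_of_nonneg_right (norm_cutAt_le hH x) (norm_nonneg _))

theorem norm_le_sqrt_mul_of_ae_bound (hH : 0 ≤ H) {f : IntervalL2 H} {C : ℝ} (hC : 0 ≤ C)
    (h : ∀ᵐ x ∂(volume.restrict (Ioo 0 H)), ‖f x‖ ≤ C) : ‖f‖ ≤ √H * C := by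
  refine (Lp.norm_le_of_ae_bound hC h).trans (le_of_eq ?_)
  have : (measureUnivNNReal (volume.restrict (Ioo 0 H)) : ℝ) = H := by
    change ((volume.restrict (Ioo 0 H)) univ).toReal = H
    simp [hH]
  rw [this, Real.sqrt_eq_rpow]
  simp

/-- The Volterra operator `f ↦ (x ↦ ∫₀ˣ f)` on `L²(0, H)`. -/
noncomputable def volterra (hH : 0 ≤ H) : IntervalL2 H →L[ℝ] IntervalL2 H :=
  LinearMap.mkContinuous
    { toFun := fun f => (memLp_inner_cutAt hH f).toLp _
      map_add' := fun f g => by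
        rw [← MemLp.toLp_add]
        exact MemLp.toLp_congr _ _ (Eventually.of_forall fun x => by simp [inner_add_right])
      map_smul' := fun a f => by
        rw [RingHom.id_apply, ← MemLp.toLp_const_smul]
        exact MemLp.toLp_congr _ _ (Eventually.of_forall fun x => by simp [inner_smul_right]) }
    (√H * √H) fun f => by
      rw [mul_assoc]
      refine norm_le_sqrt_mul_of_ae_bound hH (by positivity) ?_
      filter_upwards [(memLp_inner_cutAt hH f).coeFn_toLp] with x hx
      rw [LinearMap.coe_mk, AddHom.coe_mk, hx]
      exact (norm_inner_le_norm _ _).trans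
        (mul_le_mul_of_nonneg_right (norm_cutAt_le hH x) (norm_nonneg _))

theorem volterra_coe_inner (hH : 0 ≤ H) (f : IntervalL2 H) :
    volterra hH f =ᵐ[volume.restrict (Ioo 0 H)] fun x => inner ℝ (cutAt H x) f :=
  (memLp_inner_cutAt hH f).coeFn_toLp

theorem volterra_coe (hH : 0 ≤ H) (f : IntervalL2 H) :
    volterra hH f =ᵐ[volume.restrict (Ioo 0 H)] fun x => ∫ t in 0..x, f t := by
  filter_upwards [volterra_coe_inner hH f, ae_restrict_mem measurableSet_Ioo] with x h1 h2
  rw [h1, inner_cutAt f (Ioo_subset_Icc_self h2)]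

/-- The Volterra operator is compact. -/
theorem isCompactOperator_volterra (hH : 0 < H) : IsCompactOperator (volterra hH.le) := by
  -- The finite-rank operator `F N` replaces the primitive on each of N equal cells by its value at
  -- the left end. The Hölder bound on `cutAt` controls the error in operator norm by √H √(H/N).
  let I : ℕ → ℕ → Set ℝ := fun N j => Ico (j * (H / N)) ((j + 1) * (H / N))
  let g : ℕ → ℕ → IntervalL2 H := fun N j =>
    indicatorConstLp 2 (s := I N j) measurableSet_Ico (measure_ne_top _ _) 1
  let F : ℕ → IntervalL2 H →L[ℝ] IntervalL2 H := fun N =>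
    ∑ j ∈ Finset.range N, (innerSL ℝ (cutAt H (j * (H / N)))).smulRight (g N j)
  have hbound : ∀ N : ℕ, 0 < N → ‖F N - volterra hH.le‖ ≤ √H * √(H / N) := by
    intro N hN
    refine ContinuousLinearMap.opNorm_le_bound _ (by positivity) fun f => ?_
    rw [mul_assoc]
    refine norm_le_sqrt_mul_of_ae_bound hH.le (by positivity) ?_
    have hN' : (0 : ℝ) < N := by exact_mod_cast hN
    have hs : 0 < H / N := by positivity
    have e1 : ∀ᵐ x ∂(volume.restrict (Ioo 0 H)), ∀ j ∈ Finset.range N,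
        (inner ℝ (cutAt H (j * (H / N))) f • g N j : IntervalL2 H) x =
          inner ℝ (cutAt H (j * (H / N))) f * (I N j).indicator (fun _ => 1) x := by
      rw [Filter.eventually_all_finset]
      intro j _
      filter_upwards [Lp.coeFn_smul (inner ℝ (cutAt H (j * (H / N))) f) (g N j),
        indicatorConstLp_coeFn (p := 2) (s := I N j) (μ := volume.restrict (Ioo 0 H))
          (hs := measurableSet_Ico) (hμs := measure_ne_top _ _) (c := (1 : ℝ))] with x h1 h2
      rw [h1, Pi.smul_apply, smul_eq_mul, h2]
    have e2 : (F N f) = ∑ j ∈ Finset.range N, inner ℝ (cutAt H (j * (H / N))) f • g N j := by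
      simp [F]
    filter_upwards [Lp.coeFn_sub (F N f) (volterra hH.le f), volterra_coe_inner hH.le f, e1,
      Lp.coeFn_finsetSum (Finset.range N) (fun j => inner ℝ (cutAt H (j * (H / N))) f • g N j),
      ae_restrict_mem measurableSet_Ioo] with x h1 h2 h3 h4 hx
    rw [_root_.sub_apply, h1, Pi.sub_apply, h2, e2, h4, Finset.sum_apply,
      Finset.sum_congr rfl h3]
    set k := ⌊x / (H / N)⌋₊ with hk
    have hk1 : (k : ℝ) * (H / N) ≤ x := by
      rw [← le_div_iff₀ hs]; exact Nat.floor_le (by have := hx.1; positivity)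
    have hk2 : x < (k + 1) * (H / N) := by
      rw [← div_lt_iff₀ hs]; exact Nat.lt_floor_add_one _
    have hkN : k < N := by
      rw [hk, Nat.floor_lt (by have := hx.1; positivity), div_lt_iff₀ hs]
      have : (N : ℝ) * (H / N) = H := by field_simp
      rw [this]; exact hx.2
    rw [Finset.sum_eq_single_of_mem k (Finset.mem_range.2 hkN)]
    · rw [indicator_of_mem (show x ∈ I N k from ⟨hk1, hk2⟩), mul_one, ← inner_sub_left]
      refine (norm_inner_le_norm _ _).trans (mul_le_mul_of_nonneg_right ?_ (norm_nonneg _))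
      rw [norm_sub_rev]
      refine (norm_cutAt_sub_le hk1).trans (Real.sqrt_le_sqrt ?_)
      linarith
    · intro j _ hjk
      rw [indicator_of_notMem, mul_zero]
      intro hj
      apply hjk
      have h5 : (j : ℝ) ≤ x / (H / N) := by rw [le_div_iff₀ hs]; exact hj.1
      have h6 : x / (H / N) < j + 1 := by rw [div_lt_iff₀ hs]; exact hj.2
      exact ((Nat.floor_eq_iff (by have := hx.1; positivity)).2 ⟨h5, h6⟩).symm
  have hlim : Tendsto F atTop (𝓝 (volterra hH.le)) := by
    rw [tendsto_iff_norm_sub_tendsto_zero]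
    have h0 : Tendsto (fun N : ℕ => √H * √(H / N)) atTop (𝓝 0) := by
      have h1 : Tendsto (fun N : ℕ => H / (N : ℝ)) atTop (𝓝 0) :=
        tendsto_const_div_atTop_nhds_zero_nat H
      have h2 := (Real.continuous_sqrt.tendsto 0).comp h1
      rw [Real.sqrt_zero] at h2
      simpa using h2.const_mul (√H)
    refine squeeze_zero' (Eventually.of_forall fun N => norm_nonneg _) ?_ h0
    filter_upwards [eventually_gt_atTop 0] with N hN using hbound N hN
  refine isCompactOperator_of_tendsto hlim (Eventually.of_forall fun N => ?_)
  have hr : ∀ (x y : IntervalL2 H), IsCompactOperator ((innerSL ℝ x).smulRight y) := by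
    intro x y
    have h1 : IsCompactOperator (ContinuousLinearMap.toSpanSingleton ℝ y) :=
      isCompactOperator_of_locallyCompactSpace_rng _
    exact h1.comp_clm (innerSL ℝ x)
  exact Submodule.sum_mem (compactOperator (RingHom.id ℝ) (IntervalL2 H) (IntervalL2 H))
    (t := Finset.range N) fun j _ => hr _ _

end Volterra

/-! ### Resolvents of compact positive operators -/

section Resolvent

variable {E : Type*} [NormedAddCommGroup E] [InnerProductSpace ℝ E] [CompleteSpace E]

/-- For a compact positive symmetric operator `G` and `s ≥ 0`, the operator `(1 + s G)⁻¹ G` exists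
and is again compact, positive and symmetric. -/
theorem exists_resolvent {G : E →L[ℝ] E} (hG : IsCompactOperator G) (hsym : G.IsSymmetric)
    (hpos : ∀ x, 0 ≤ inner ℝ (G x) x) {s : ℝ} (hs : 0 ≤ s) :
    ∃ R : E →L[ℝ] E, (∀ f u, R f = u ↔ u + s • G u = G f) ∧ IsCompactOperator R ∧
      R.IsSymmetric ∧ ∀ x, 0 ≤ inner ℝ (R x) x := by
  let A : E →L[ℝ] E := ContinuousLinearMap.id ℝ E + s • G
  let B : E →L[ℝ] E →L[ℝ] ℝ := (innerSL ℝ).comp A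
  -- Positivity of G makes 1 + sG coercive with constant 1, so Lax–Milgram inverts it.
  have hB : IsCoercive B := by
    refine ⟨1, one_pos, fun x => ?_⟩
    have : B x x = inner ℝ x x + s * inner ℝ (G x) x := by
      change inner ℝ (x + s • G x) x = _
      rw [inner_add_left, real_inner_smul_left]
    rw [this, real_inner_self_eq_norm_sq]
    have := mul_nonneg hs (hpos x)
    nlinarith
  let L := hB.continuousLinearEquivOfBilin
  have hL : ∀ x, L x = x + s • G x := by
    intro x
    refine ext_inner_right ℝ fun y => ?_
    exact hB.continuousLinearEquivOfBilin_apply x y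
  let R : E →L[ℝ] E := (L.symm : E →L[ℝ] E).comp G
  have hR : ∀ f u, R f = u ↔ u + s • G u = G f := by
    intro f u
    rw [← hL]
    change L.symm (G f) = u ↔ _
    rw [ContinuousLinearEquiv.symm_apply_eq]
    exact eq_comm
  have hR' : ∀ f, R f = G (f - s • R f) := by
    intro f
    have := (hR f (R f)).1 rfl
    rw [map_sub, map_smul, ← this, add_sub_cancel_right]
  -- Both terms on the right inherit symmetry and nonnegativity from G and s ≥ 0. No commutation of
  -- G with the inverse of 1 + sG is needed.
  have hbil : ∀ f g, inner ℝ (R f) g =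
      inner ℝ (G (f - s • R f)) (g - s • R g) + s * inner ℝ (R f) (R g) := by
    intro f g
    rw [← hR', inner_sub_right, real_inner_smul_right]
    ring
  refine ⟨R, hR, hG.clm_comp (L.symm : E →L[ℝ] E), fun f g => ?_, fun f => ?_⟩
  · have h1 := hbil f g
    have h2 := hbil g f
    have h3 : inner ℝ (G (f - s • R f)) (g - s • R g) =
      inner ℝ (f - s • R f) (G (g - s • R g)) := hsym _ _
    change inner ℝ (R f) g = inner ℝ f (R g)
    rw [real_inner_comm (R g) f, h1, h2, h3, real_inner_comm (G (g - s • R g)),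
      real_inner_comm (R f) (R g)]
  · rw [hbil f f]
    exact add_nonneg (hpos _) (mul_nonneg hs real_inner_self_nonneg)

end Resolvent

/-! ### The Dirichlet Green operator on an interval -/

section Green

variable {H : ℝ}

/-- Essentially bounded functions act on `L²(0, H)` by multiplication. -/
theorem memLp_bdd_mul {b : ℝ → ℝ} {C : ℝ}
    (hb : AEStronglyMeasurable b (volume.restrict (Ioo 0 H)))
    (hC : ∀ᵐ x ∂(volume.restrict (Ioo 0 H)), ‖b x‖ ≤ C) {f : ℝ → ℝ}
    (hf : MemLp f 2 (volume.restrict (Ioo 0 H))) :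
    MemLp (fun x => b x * f x) 2 (volume.restrict (Ioo 0 H)) := by
  refine MemLp.of_le_mul (c := C) hf (hb.mul hf.1) ?_
  filter_upwards [hC] with x hx
  rw [norm_mul]
  exact mul_le_mul_of_nonneg_right hx (norm_nonneg _)

/-- Multiplication by an essentially bounded function on `L²(0, H)`. -/
theorem exists_mulOperator {b : ℝ → ℝ} {C : ℝ}
    (hb : AEStronglyMeasurable b (volume.restrict (Ioo 0 H)))
    (hC : ∀ᵐ x ∂(volume.restrict (Ioo 0 H)), ‖b x‖ ≤ C) :
    ∃ D : IntervalL2 H →L[ℝ] IntervalL2 H,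
      (∀ f, D f =ᵐ[volume.restrict (Ioo 0 H)] fun x => b x * f x) ∧ D.IsSymmetric := by
  have hm : ∀ f : IntervalL2 H, MemLp (fun x => b x * f x) 2 (volume.restrict (Ioo 0 H)) :=
    fun f => memLp_bdd_mul hb hC (Lp.memLp f)
  let D : IntervalL2 H →L[ℝ] IntervalL2 H := LinearMap.mkContinuous
    { toFun := fun f => (hm f).toLp _
      map_add' := fun f g => by
        rw [← MemLp.toLp_add]
        refine MemLp.toLp_congr _ _ ?_
        filter_upwards [Lp.coeFn_add f g] with x hx
        rw [hx]; simp [mul_add]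
      map_smul' := fun a f => by
        rw [RingHom.id_apply, ← MemLp.toLp_const_smul]
        refine MemLp.toLp_congr _ _ ?_
        filter_upwards [Lp.coeFn_smul a f] with x hx
        rw [hx]; simp [mul_left_comm] } C fun f => by
      refine Lp.norm_le_mul_norm_of_ae_le_mul ?_
      filter_upwards [(hm f).coeFn_toLp, hC] with x h1 h2
      rw [LinearMap.coe_mk, AddHom.coe_mk, h1, norm_mul]
      exact mul_le_mul_of_nonneg_right h2 (norm_nonneg _)
  have hD : ∀ f, D f =ᵐ[volume.restrict (Ioo 0 H)] fun x => b x * f x :=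
    fun f => (hm f).coeFn_toLp
  refine ⟨D, hD, fun f g => ?_⟩
  change inner ℝ (D f) g = inner ℝ f (D g)
  rw [L2.inner_def, L2.inner_def]
  refine integral_congr_ae ?_
  filter_upwards [hD f, hD g] with x h1 h2
  rw [h1, h2]
  simp only [RCLike.inner_apply, conj_trivial]
  ring

theorem intervalIntegral_congr_of_ae_restrict {f g : ℝ → ℝ}
    (h : f =ᵐ[volume.restrict (Ioo 0 H)] g) {x : ℝ} (hx : x ∈ Icc 0 H) :
    ∫ t in 0..x, f t = ∫ t in 0..x, g t := by
  have hne : ∀ᵐ t : ℝ, t ≠ H := by simp [ae_iff, measure_singleton]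
  refine intervalIntegral.integral_congr_ae ?_
  rw [uIoc_of_le hx.1]
  filter_upwards [(ae_restrict_iff' measurableSet_Ioo).1 h, hne] with t ht htH htx
  exact ht ⟨htx.1, lt_of_le_of_ne (htx.2.trans hx.2) htH⟩

/-- The derivative at `0` of the solution of `-u'' = f`, `u(0) = u(H) = 0`. -/
noncomputable def greenSlope (H : ℝ) (f : ℝ → ℝ) : ℝ := H⁻¹ * ∫ x in 0..H, ∫ t in 0..x, f t

/-- The solution operator of `-u'' = f`, `u(0) = u(H) = 0` on `L²(0, H)`. -/
noncomputable def green (hH : 0 < H) : IntervalL2 H →L[ℝ] IntervalL2 H :=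
  -- With V the Volterra operator, the solution is u = a x - V V f, where a = H⁻¹ (V V f)(H). Here
  -- `cutAt H H` is the constant 1, so V of it is the function x, and pairing with it integrates
  -- over (0, H).
  H⁻¹ • (innerSL ℝ (cutAt H H)).smulRight (volterra hH.le (cutAt H H)) ∘L volterra hH.le -
    volterra hH.le ∘L volterra hH.le

theorem isCompactOperator_green (hH : 0 < H) : IsCompactOperator (green hH) := by
  have hV := isCompactOperator_volterra hH
  have h1 := hV.clm_comp (H⁻¹ • (innerSL ℝ (cutAt H H)).smulRight (volterra hH.le (cutAt H H)))
  have h2 := hV.clm_comp (volterra hH.le)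
  exact h1.sub h2

theorem intervalIntegrable_primitive {f : ℝ → ℝ} (hf : IntervalIntegrable f volume 0 H) (a : ℝ) :
    IntervalIntegrable (fun x => a + ∫ t in 0..x, f t) volume 0 H :=
  (continuousOn_primitive' hf a).intervalIntegrable

/-- This is the boundary condition at H: `greenSlope` is the initial slope that brings the solution
back to 0 there. -/
theorem integral_greenSlope_sub (hH : 0 < H) {f : ℝ → ℝ}
    (hf : IntervalIntegrable f volume 0 H) :
    ∫ x in 0..H, (greenSlope H f + ∫ t in 0..x, -f t) = 0 := by
  have h1 : IntervalIntegrable (fun x => ∫ t in 0..x, -f t) volume 0 H := by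
    simpa using intervalIntegrable_primitive hf.neg 0
  rw [intervalIntegral.integral_add (by simp) h1]
  simp only [intervalIntegral.integral_neg, intervalIntegral.integral_const, sub_zero, smul_eq_mul,
    greenSlope]
  field_simp
  ring

/-- A representative in the form of an iterated primitive, to which integration by parts applies. -/
theorem green_coe (hH : 0 < H) (f : IntervalL2 H) :
    green hH f =ᵐ[volume.restrict (Ioo 0 H)]
      fun x => ∫ t in 0..x, (greenSlope H f + ∫ s in 0..t, -f s) := by
  set V := volterra hH.le with hV
  have e1 : green hH f = (H⁻¹ * inner ℝ (cutAt H H) (V f)) • V (cutAt H H) - V (V f) := by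
    simp [green, hV, smul_smul]
  have e2 : inner ℝ (cutAt H H) (V f) = ∫ x in 0..H, ∫ t in 0..x, f t := by
    rw [inner_cutAt _ (right_mem_Icc.2 hH.le)]
    exact intervalIntegral_congr_of_ae_restrict (volterra_coe hH.le f) (right_mem_Icc.2 hH.le)
  have e3 : cutAt H H =ᵐ[volume.restrict (Ioo 0 H)] fun _ => 1 := by
    filter_upwards [indicatorConstLp_coeFn (p := 2) (s := Iic H) (μ := volume.restrict (Ioo 0 H))
      (hs := measurableSet_Iic) (hμs := measure_ne_top _ _) (c := (1 : ℝ)),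
      ae_restrict_mem measurableSet_Ioo] with x h1 h2
    rw [cutAt, h1, indicator_of_mem (show x ∈ Iic H from h2.2.le)]
  have hfi := Lp.intervalIntegrable_of_restrict_Ioo hH.le (Lp.memLp f)
  rw [e1, e2]
  filter_upwards [Lp.coeFn_sub ((H⁻¹ * ∫ x in 0..H, ∫ t in 0..x, f t) • V (cutAt H H)) (V (V f)),
    Lp.coeFn_smul (H⁻¹ * ∫ x in 0..H, ∫ t in 0..x, f t) (V (cutAt H H)),
    volterra_coe hH.le (cutAt H H), volterra_coe hH.le (V f), ae_restrict_mem measurableSet_Ioo]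
    with x h1 h2 h3 h4 hx
  have hxI := Ioo_subset_Icc_self hx
  rw [h1, Pi.sub_apply, h2, Pi.smul_apply, h3, h4, intervalIntegral_congr_of_ae_restrict e3 hxI,
    intervalIntegral_congr_of_ae_restrict (volterra_coe hH.le f) hxI]
  have h5 : IntervalIntegrable (fun x => ∫ t in 0..x, -f t) volume 0 x := by
    have := intervalIntegrable_primitive hfi.neg 0
    simp only [Pi.neg_apply, zero_add] at this
    refine this.mono_set ?_
    rw [uIcc_of_le hx.1.le, uIcc_of_le hH.le]
    exact Icc_subset_Icc_right hx.2.le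
  rw [intervalIntegral.integral_add (by simp) h5]
  simp only [intervalIntegral.integral_neg, intervalIntegral.integral_const, sub_zero, smul_eq_mul,
    greenSlope]
  ring

/-- The solution of `-u'' = g`, `u(0) = u(H) = 0` is unique. -/
theorem green_ae_eq (hH : 0 < H) {f : IntervalL2 H} {g : ℝ → ℝ}
    (hfg : f =ᵐ[volume.restrict (Ioo 0 H)] g) {b : ℝ}
    (hb : ∫ x in 0..H, (b + ∫ t in 0..x, -g t) = 0) :
    green hH f =ᵐ[volume.restrict (Ioo 0 H)] fun x => ∫ t in 0..x, (b + ∫ s in 0..t, -g s) := by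
  have hfi := Lp.intervalIntegrable_of_restrict_Ioo hH.le (Lp.memLp f)
  have hneg : (fun t => -f t) =ᵐ[volume.restrict (Ioo 0 H)] fun t => -g t := by
    filter_upwards [hfg] with x hx; rw [hx]
  have hcongr : ∀ (a : ℝ), ∀ x ∈ Icc 0 H,
      ∫ t in 0..x, (a + ∫ s in 0..t, -f s) = ∫ t in 0..x, (a + ∫ s in 0..t, -g s) := by
    intro a x hx
    refine intervalIntegral.integral_congr fun t ht => ?_
    rw [uIcc_of_le hx.1] at ht
    rw [intervalIntegral_congr_of_ae_restrict hneg ⟨ht.1, ht.2.trans hx.2⟩]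
  have hslope : greenSlope H f = b := by
    have h1 := integral_greenSlope_sub hH hfi
    rw [← hcongr b H (right_mem_Icc.2 hH.le)] at hb
    have h2 : IntervalIntegrable (fun x => ∫ t in 0..x, -f t) volume 0 H := by
      simpa using intervalIntegrable_primitive hfi.neg 0
    rw [intervalIntegral.integral_add (by simp) h2] at h1 hb
    simp only [intervalIntegral.integral_const, sub_zero, smul_eq_mul] at h1 hb
    have : H * (greenSlope H f - b) = 0 := by linarith
    rcases mul_eq_zero.1 this with h | h
    · exact absurd h hH.ne'
    · linarith
  filter_upwards [green_coe hH f, ae_restrict_mem measurableSet_Ioo] with x h1 h2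
  rw [h1, hslope, hcongr b x (Ioo_subset_Icc_self h2)]

/-- One integration by parts gives ⟨Gf, g⟩ = ∫ (Gf)' (Gg)', the boundary terms vanishing because Gf
is 0 at both ends. Symmetry and positivity of G are read off from this form. -/
theorem inner_green (hH : 0 < H) (f g : IntervalL2 H) :
    inner ℝ (green hH f) g = ∫ x in 0..H,
      (greenSlope H f + ∫ t in 0..x, -f t) * (greenSlope H g + ∫ t in 0..x, -g t) := by
  have hf := Lp.intervalIntegrable_of_restrict_Ioo hH.le (Lp.memLp f)
  have hg := Lp.intervalIntegrable_of_restrict_Ioo hH.le (Lp.memLp g)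
  rw [inner_eq_intervalIntegral hH.le]
  have h1 : ∫ x in 0..H, (green hH f) x * g x =
      ∫ x in 0..H, (∫ t in 0..x, (greenSlope H f + ∫ s in 0..t, -f s)) * g x := by
    refine intervalIntegral_congr_of_ae_restrict ?_ (right_mem_Icc.2 hH.le)
    filter_upwards [green_coe hH f] with x hx
    rw [hx]
  have h2 := integral_primitive_mul (intervalIntegrable_primitive hf.neg (greenSlope H f)) hg.neg
    0 (greenSlope H g)
  simp only [Pi.neg_apply, zero_add, zero_mul, sub_zero, mul_neg,
    intervalIntegral.integral_neg (f := fun x => (∫ t in 0..x, _) * g x)] at h2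
  rw [integral_greenSlope_sub hH hf] at h2
  rw [h1]
  linarith

theorem isSymmetric_green (hH : 0 < H) : (green hH).IsSymmetric := by
  intro f g
  change inner ℝ (green hH f) g = inner ℝ f (green hH g)
  rw [real_inner_comm (green hH g) f, inner_green, inner_green]
  simp only [mul_comm]

theorem inner_green_self_nonneg (hH : 0 < H) (f : IntervalL2 H) :
    0 ≤ inner ℝ (green hH f) f := by
  rw [inner_green]
  exact intervalIntegral.integral_nonneg hH.le fun x _ => mul_self_nonneg _

end Green

/-! ### Weak derivatives -/

section L2Limits

variable {α : Type*} [MeasurableSpace α] {ν : Measure α}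

theorem inner_toLp_eq_integral {f g : α → ℝ} (hf : MemLp f 2 ν) (hg : MemLp g 2 ν) :
    inner ℝ (hf.toLp f) (hg.toLp g) = ∫ x, f x * g x ∂ν := by
  rw [L2.inner_def]
  refine integral_congr_ae ?_
  filter_upwards [hf.coeFn_toLp, hg.coeFn_toLp] with x h1 h2
  rw [h1, h2]
  simp [mul_comm]

theorem tendsto_toLp_of_eLpNorm_sub {u : α → ℝ} {φ : ℕ → α → ℝ} (hu : MemLp u 2 ν)
    (hφ : ∀ n, MemLp (φ n) 2 ν)
    (h : Tendsto (fun n => eLpNorm (fun x => u x - φ n x) 2 ν) atTop (𝓝 0)) :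
    Tendsto (fun n => (hφ n).toLp (φ n)) atTop (𝓝 (hu.toLp u)) := by
  rw [Lp.tendsto_Lp_iff_tendsto_eLpNorm'']
  refine h.congr fun n => ?_
  rw [eLpNorm_sub_comm]
  rfl

theorem tendsto_eLpNorm_sub_of_tendsto_toLp {u : α → ℝ} {φ : ℕ → α → ℝ} (hu : MemLp u 2 ν)
    (hφ : ∀ n, MemLp (φ n) 2 ν)
    (h : Tendsto (fun n => (hφ n).toLp (φ n)) atTop (𝓝 (hu.toLp u))) :
    Tendsto (fun n => eLpNorm (fun x => u x - φ n x) 2 ν) atTop (𝓝 0) := by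
  rw [Lp.tendsto_Lp_iff_tendsto_eLpNorm''] at h
  refine h.congr fun n => ?_
  rw [eLpNorm_sub_comm]
  rfl

/-- `L²` convergence of two sequences implies convergence of the integrals of the products. -/
theorem tendsto_integral_mul_of_eLpNorm_sub {u w : α → ℝ} {φ ψ : ℕ → α → ℝ} (hu : MemLp u 2 ν)
    (hw : MemLp w 2 ν) (hφ : ∀ n, MemLp (φ n) 2 ν) (hψ : ∀ n, MemLp (ψ n) 2 ν)
    (h : Tendsto (fun n => eLpNorm (fun x => u x - φ n x) 2 ν) atTop (𝓝 0))
    (h' : Tendsto (fun n => eLpNorm (fun x => w x - ψ n x) 2 ν) atTop (𝓝 0)) :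
    Tendsto (fun n => ∫ x, φ n x * ψ n x ∂ν) atTop (𝓝 (∫ x, u x * w x ∂ν)) := by
  have := (tendsto_toLp_of_eLpNorm_sub hu hφ h).inner (tendsto_toLp_of_eLpNorm_sub hw hψ h')
    (𝕜 := ℝ)
  rw [inner_toLp_eq_integral] at this
  refine this.congr fun n => ?_
  rw [inner_toLp_eq_integral]

theorem tendsto_integral_mul_const_of_eLpNorm_sub {u w : α → ℝ} {φ : ℕ → α → ℝ} (hu : MemLp u 2 ν)
    (hw : MemLp w 2 ν) (hφ : ∀ n, MemLp (φ n) 2 ν)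
    (h : Tendsto (fun n => eLpNorm (fun x => u x - φ n x) 2 ν) atTop (𝓝 0)) :
    Tendsto (fun n => ∫ x, φ n x * w x ∂ν) atTop (𝓝 (∫ x, u x * w x ∂ν)) :=
  tendsto_integral_mul_of_eLpNorm_sub hu hw hφ (fun _ => hw) h (by simp)

end L2Limits

/-! ### Test functions and weak derivatives on open sets -/

section WeakDeriv

variable {E : Type*} [NormedAddCommGroup E] [NormedSpace ℝ E] {U : Set E}

theorem IsTestFn.eq_zero_of_notMem {φ : E → ℝ} (hφ : IsTestFn U φ) {x : E} (hx : x ∉ U) :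
    φ x = 0 :=
  image_eq_zero_of_notMem_tsupport fun h => hx (hφ.2.2 h)

theorem IsTestFn.fderiv_apply {φ : E → ℝ} (hφ : IsTestFn U φ) (v : E) :
    IsTestFn U (fun x => fderiv ℝ φ x v) := by
  have hs : tsupport (fun x => fderiv ℝ φ x v) ⊆ tsupport φ := by
    refine (closure_mono ?_).trans (tsupport_fderiv_subset ℝ (f := φ))
    intro x hx h0
    exact hx (by simp only [h0, _root_.zero_apply])
  refine ⟨?_, hφ.2.1.of_isClosed_subset (isClosed_tsupport _) hs, hs.trans hφ.2.2⟩
  exact (contDiff_infty_iff_fderiv.1 hφ.1).2.clm_apply contDiff_const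

theorem IsTestFn.const_mul {φ : E → ℝ} (hφ : IsTestFn U φ) (a : ℝ) :
    IsTestFn U (fun x => a * φ x) :=
  ⟨contDiff_const.mul hφ.1, hφ.2.1.mul_left,
    (tsupport_mul_subset_right (f := fun _ => a) (g := φ)).trans hφ.2.2⟩

theorem IsTestFn.sub {φ ψ : E → ℝ} (hφ : IsTestFn U φ) (hψ : IsTestFn U ψ) :
    IsTestFn U (fun x => φ x - ψ x) := by
  refine ⟨hφ.1.sub hψ.1, hφ.2.1.sub hψ.2.1, (tsupport_sub φ ψ).trans ?_⟩
  exact union_subset hφ.2.2 hψ.2.2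

variable [MeasureSpace E]

theorem HasWeakDirDeriv.congr {u u' g g' : E → ℝ} {v : E} (h : HasWeakDirDeriv U v u g)
    (hu : u =ᵐ[volume.restrict U] u') (hg : g =ᵐ[volume.restrict U] g') :
    HasWeakDirDeriv U v u' g' := by
  refine ⟨h.1.congr hu, h.2.1.congr hg, fun φ hφ => ?_⟩
  have h1 := h.2.2 φ hφ
  have e1 : ∫ x in U, u x * fderiv ℝ φ x v = ∫ x in U, u' x * fderiv ℝ φ x v :=
    integral_congr_ae (hu.mul (ae_eq_refl fun x => fderiv ℝ φ x v))
  have e2 : ∫ x in U, g x * φ x = ∫ x in U, g' x * φ x :=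
    integral_congr_ae (hg.mul (ae_eq_refl φ))
  rw [← e1, ← e2, h1]

theorem HasWeakDirDeriv.smul_dir {u g : E → ℝ} {v : E} (h : HasWeakDirDeriv U v u g) (a : ℝ) :
    HasWeakDirDeriv U (a • v) u (fun x => a * g x) := by
  refine ⟨h.1, h.2.1.smul a, fun φ hφ => ?_⟩
  simp only [map_smul, smul_eq_mul, mul_left_comm _ a, mul_assoc]
  rw [integral_const_mul, integral_const_mul, h.2.2 φ hφ, mul_neg]

variable [BorelSpace E]

theorem IsTestFn.memLp [IsFiniteMeasureOnCompacts (volume : Measure E)] {φ : E → ℝ}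
    (hφ : IsTestFn U φ) (p : ENNReal) (V : Set E) : MemLp φ p (volume.restrict V) :=
  (hφ.1.continuous.memLp_of_hasCompactSupport hφ.2.1).restrict V

/-- Local integrability on U is enough because the support of φ is a compact subset of U. -/
theorem integrableOn_mul_testFn {g φ : E → ℝ}
    (hg : LocallyIntegrableOn g U) (hφ : IsTestFn U φ) :
    IntegrableOn (fun x => g x * φ x) U := by
  have h1 : IntegrableOn g (tsupport φ) := hg.integrableOn_compact_subset hφ.2.2 hφ.2.1
  have h2 : IntegrableOn (fun x => g x * φ x) (tsupport φ) :=
    h1.mul_continuousOn hφ.1.continuous.continuousOn hφ.2.1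
  have h3 : Integrable (fun x => g x * φ x) := by
    rw [integrableOn_iff_integrable_of_support_subset] at h2
    · exact h2
    · intro x hx
      by_contra h
      exact hx (by simp [image_eq_zero_of_notMem_tsupport h])
  exact h3.integrableOn

variable [FiniteDimensional ℝ E]

/-- The fundamental lemma of the calculus of variations. -/
theorem ae_eq_zero_of_forall_testFn (hU : IsOpen U) {g : E → ℝ} (hg : LocallyIntegrableOn g U)
    (h : ∀ φ, IsTestFn U φ → ∫ x in U, g x * φ x = 0) : ∀ᵐ x ∂(volume.restrict U), g x = 0 := by
  rw [ae_restrict_iff' hU.measurableSet]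
  refine hU.ae_eq_zero_of_integral_contDiff_smul_eq_zero hg fun φ h1 h2 h3 => ?_
  have hφ : IsTestFn U φ := ⟨h1, h2, h3⟩
  rw [← h φ hφ, setIntegral_eq_integral_of_forall_compl_eq_zero]
  · simp [mul_comm]
  · intro x hx; simp [hφ.eq_zero_of_notMem hx]

/-- The difference of the two derivatives annihilates all test functions. This identifies the
derivative supplied by `IsH10` with the one occurring in an eigenvalue equation. -/
theorem HasWeakDirDeriv.ae_unique (hU : IsOpen U) {u u' g g' : E → ℝ} {v : E}
    (h : HasWeakDirDeriv U v u g) (h' : HasWeakDirDeriv U v u' g')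
    (hu : u =ᵐ[volume.restrict U] u') :
    g =ᵐ[volume.restrict U] g' := by
  have h'' := h'.congr hu.symm (ae_eq_refl g')
  have := ae_eq_zero_of_forall_testFn hU (h.2.1.sub h''.2.1) fun φ hφ => by
    simp only [Pi.sub_apply, sub_mul]
    rw [integral_sub (integrableOn_mul_testFn h.2.1 hφ) (integrableOn_mul_testFn h''.2.1 hφ)]
    have h1 := h.2.2 φ hφ
    have h2 := h''.2.2 φ hφ
    linarith
  filter_upwards [this] with x hx
  simpa [sub_eq_zero] using hx

end WeakDeriv

/-! ### Sobolev functions on an interval as primitives -/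

section WeakDerivInterval

variable {H : ℝ}

theorem IsTestFn.exists_Icc {φ : ℝ → ℝ} (hφ : IsTestFn (Ioo 0 H) φ) (hH : 0 < H) :
    ∃ a b, 0 < a ∧ a < b ∧ b < H ∧ ∀ x, x ∉ Icc a b → φ x = 0 := by
  rcases (tsupport φ).eq_empty_or_nonempty with h | h
  · refine ⟨H / 3, H / 2, by linarith, by linarith, by linarith, fun x _ => ?_⟩
    exact image_eq_zero_of_notMem_tsupport (by simp [h])
  · have hc : IsCompact (tsupport φ) := hφ.2.1
    obtain ⟨a, ha, ha'⟩ := hc.exists_isLeast h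
    obtain ⟨b, hb, hb'⟩ := hc.exists_isGreatest h
    have h1 := hφ.2.2 ha
    have h2 := hφ.2.2 hb
    refine ⟨a / 2, (b + H) / 2, by linarith [h1.1], ?_, by linarith [h2.2], fun x hx => ?_⟩
    · linarith [ha' hb, h1.1, h2.2]
    · apply image_eq_zero_of_notMem_tsupport
      intro hx'
      exact hx ⟨by linarith [ha' hx', h1.1], by linarith [hb' hx', h2.2]⟩

theorem isTestFn_of_forall_notMem_Icc {φ : ℝ → ℝ} (hφ : ContDiff ℝ ∞ φ) {a b : ℝ} (ha : 0 < a)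
    (hb : b < H) (h : ∀ x, x ∉ Icc a b → φ x = 0) : IsTestFn (Ioo 0 H) φ := by
  have hs : tsupport φ ⊆ Icc a b := by
    refine closure_minimal (fun x hx => ?_) isClosed_Icc
    by_contra h'
    exact hx (h x h')
  exact ⟨hφ, HasCompactSupport.of_support_subset_isCompact isCompact_Icc
    ((subset_tsupport φ).trans hs), hs.trans fun x hx => ⟨ha.trans_le hx.1, hx.2.trans_lt hb⟩⟩

/-- The primitive of a test function with zero mean is a test function. -/
theorem isTestFn_primitive (hH : 0 < H) {ψ : ℝ → ℝ} (hψ : IsTestFn (Ioo 0 H) ψ)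
    (hint : ∫ x in 0..H, ψ x = 0) :
    IsTestFn (Ioo 0 H) (fun x => ∫ t in 0..x, ψ t) ∧
      ∀ x, fderiv ℝ (fun x => ∫ t in 0..x, ψ t) x 1 = ψ x := by
  have hc : Continuous ψ := hψ.1.continuous
  have hd : ∀ x, HasDerivAt (fun x => ∫ t in 0..x, ψ t) (ψ x) x := fun x =>
    intervalIntegral.integral_hasDerivAt_right (hc.intervalIntegrable _ _)
      (hc.stronglyMeasurableAtFilter _ _) hc.continuousAt
  have hderiv : deriv (fun x => ∫ t in 0..x, ψ t) = ψ := funext fun x => (hd x).deriv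
  obtain ⟨a, b, ha, hab, hb, hz⟩ := hψ.exists_Icc hH
  refine ⟨isTestFn_of_forall_notMem_Icc ?_ ha hb fun x hx => ?_, fun x => ?_⟩
  · rw [contDiff_infty_iff_deriv, hderiv]
    exact ⟨fun x => (hd x).differentiableAt, hψ.1⟩
  · have hzero : ∀ s t : ℝ, (∀ y ∈ uIoc s t, y ∉ Icc a b) → ∫ y in s..t, ψ y = 0 := by
      intro s t hst
      rw [intervalIntegral.integral_congr_ae (g := fun _ => 0), intervalIntegral.integral_zero]
      exact Eventually.of_forall fun y hy => hz y (hst y hy)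
    rcases lt_or_ge x a with h | h
    · refine hzero 0 x fun y hy hy' => ?_
      have : y ≤ max 0 x := hy.2
      have : max 0 x < a := max_lt ha h
      linarith [hy'.1]
    · have hxb : b < x := by
        by_contra hxb
        exact hx ⟨h, not_lt.1 hxb⟩
      have h1 := intervalIntegral.integral_add_adjacent_intervals
        (hc.intervalIntegrable (μ := volume) 0 x) (hc.intervalIntegrable x H)
      rw [hint, hzero x H, add_zero] at h1
      · exact h1
      · intro y hy hy'
        have : min x H < y := hy.1
        have : b < min x H := lt_min hxb hb
        linarith [hy'.2]
  · rw [fderiv_apply_one_eq_deriv]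
    exact (hd x).deriv

theorem IsTestFn.apply_zero {φ : ℝ → ℝ} (hφ : IsTestFn (Ioo 0 H) φ) : φ 0 = 0 :=
  hφ.eq_zero_of_notMem fun h => lt_irrefl _ h.1

theorem IsTestFn.apply_right {φ : ℝ → ℝ} (hφ : IsTestFn (Ioo 0 H) φ) : φ H = 0 :=
  hφ.eq_zero_of_notMem fun h => lt_irrefl _ h.2

theorem IsTestFn.eq_primitive {φ : ℝ → ℝ} (hφ : IsTestFn (Ioo 0 H) φ) (x : ℝ) :
    ∫ t in 0..x, fderiv ℝ φ t 1 = φ x := by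
  have hd : ∀ t, HasDerivAt φ (fderiv ℝ φ t 1) t := fun t => by
    rw [fderiv_apply_one_eq_deriv]
    exact (hφ.1.differentiable (by simp) t).hasDerivAt
  rw [intervalIntegral.integral_eq_sub_of_hasDerivAt (fun t _ => hd t)
    ((hφ.fderiv_apply 1).1.continuous.intervalIntegrable _ _), hφ.apply_zero, sub_zero]

/-- A primitive has the primitive's integrand as its weak derivative. -/
theorem hasWeakDirDeriv_primitive (hH : 0 ≤ H) {p : ℝ → ℝ} (hp : IntervalIntegrable p volume 0 H)
    (a : ℝ) : HasWeakDirDeriv (Ioo 0 H) 1 (fun x => a + ∫ t in 0..x, p t) p := by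
  have hpi : IntegrableOn p (Ioo 0 H) :=
    (intervalIntegrable_iff_integrableOn_Ioo_of_le hH).1 hp
  have hPi : IntegrableOn (fun x => a + ∫ t in 0..x, p t) (Ioo 0 H) :=
    (intervalIntegrable_iff_integrableOn_Ioo_of_le hH).1 (intervalIntegrable_primitive hp a)
  refine ⟨hPi.locallyIntegrableOn, hpi.locallyIntegrableOn, fun φ hφ => ?_⟩
  rw [integral_Ioo_eq_intervalIntegral hH, integral_Ioo_eq_intervalIntegral hH]
  have := integral_primitive_mul hp
    ((hφ.fderiv_apply 1).1.continuous.intervalIntegrable (μ := volume) 0 H) a 0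
  simp only [hφ.eq_primitive, zero_add, mul_zero, sub_zero, hφ.apply_right, zero_sub] at this
  exact this

/-- Subtracting a multiple of such a bump makes the mean of a test function vanish, and then its
primitive is again a test function. -/
theorem exists_testFn_integral_eq_one (hH : 0 < H) :
    ∃ η : ℝ → ℝ, IsTestFn (Ioo 0 H) η ∧ ∫ x in 0..H, η x = 1 := by
  let f : ContDiffBump (H / 2) := ⟨H / 8, H / 4, by linarith, by linarith⟩
  refine ⟨f.normed volume, ⟨f.contDiff_normed, f.hasCompactSupport_normed, ?_⟩, ?_⟩
  · rw [f.tsupport_normed_eq]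
    intro x hx
    rw [Real.closedBall_eq_Icc] at hx
    simp only [f] at hx
    exact ⟨by linarith [hx.1], by linarith [hx.2]⟩
  · rw [← f.integral_normed (μ := volume), ← integral_Ioo_eq_intervalIntegral hH.le,
      setIntegral_eq_integral_of_forall_compl_eq_zero]
    intro x hx
    have : x ∉ Function.support (f.normed volume) := by
      rw [f.support_normed_eq]
      intro h
      rw [Real.ball_eq_Ioo] at h
      simp only [f] at h
      exact hx ⟨by linarith [h.1], by linarith [h.2]⟩
    simpa using this

/-- **du Bois-Reymond lemma**: a function with integrable weak derivative on `(0, H)` is a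
primitive of it, up to a constant. -/
theorem HasWeakDirDeriv.exists_ae_eq_primitive (hH : 0 < H) {u p : ℝ → ℝ}
    (h : HasWeakDirDeriv (Ioo 0 H) 1 u p) (hp : IntervalIntegrable p volume 0 H) :
    ∃ a, u =ᵐ[volume.restrict (Ioo 0 H)] fun x => a + ∫ t in 0..x, p t := by
  have hP := hasWeakDirDeriv_primitive hH.le hp 0
  have hv : LocallyIntegrableOn (u - fun x => 0 + ∫ t in 0..x, p t) (Ioo 0 H) := h.1.sub hP.1
  set v : ℝ → ℝ := u - fun x => 0 + ∫ t in 0..x, p t with hvdef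
  have hvz : ∀ φ, IsTestFn (Ioo 0 H) φ → ∫ x in Ioo 0 H, v x * fderiv ℝ φ x 1 = 0 := by
    intro φ hφ
    have h1 := h.2.2 φ hφ
    have h2 := hP.2.2 φ hφ
    simp only [hvdef, Pi.sub_apply, sub_mul]
    rw [integral_sub (integrableOn_mul_testFn h.1 (hφ.fderiv_apply 1))
      (integrableOn_mul_testFn hP.1 (hφ.fderiv_apply 1)), h1, h2, sub_self]
  obtain ⟨η, hη, hη1⟩ := exists_testFn_integral_eq_one hH
  -- v annihilates derivatives of test functions. For any ψ with integral b, ψ - b η is such a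
  -- derivative, hence ∫ v ψ = b ∫ v η = a ∫ ψ and v = a.
  set a := ∫ x in Ioo 0 H, v x * η x with ha
  have hca : LocallyIntegrableOn (fun _ : ℝ => a) (Ioo 0 H) :=
    (locallyIntegrable_const a).locallyIntegrableOn _
  have hz := ae_eq_zero_of_forall_testFn isOpen_Ioo (hv.sub hca) fun ψ hψ => by
    set b := ∫ x in 0..H, ψ x with hb
    have hψ' : IsTestFn (Ioo 0 H) (fun x => ψ x - b * η x) := hψ.sub (hη.const_mul b)
    have hint : ∫ x in 0..H, (ψ x - b * η x) = 0 := by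
      rw [intervalIntegral.integral_sub (hψ.1.continuous.intervalIntegrable _ _)
        ((hη.const_mul b).1.continuous.intervalIntegrable _ _),
        intervalIntegral.integral_const_mul, hη1, mul_one, sub_self]
    obtain ⟨h1, h2⟩ := isTestFn_primitive hH hψ' hint
    have h3 := hvz _ h1
    simp only [h2, mul_sub] at h3
    rw [integral_sub (integrableOn_mul_testFn hv hψ)
      (integrableOn_mul_testFn hv (hη.const_mul b))] at h3
    simp only [mul_left_comm _ b] at h3
    rw [integral_const_mul, ← ha] at h3
    simp only [Pi.sub_apply, sub_mul]
    rw [integral_sub (integrableOn_mul_testFn hv hψ) (integrableOn_mul_testFn hca hψ),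
      integral_const_mul, integral_Ioo_eq_intervalIntegral hH.le ψ, ← hb]
    linarith
  refine ⟨a, ?_⟩
  filter_upwards [hz] with x hx
  simp only [hvdef, Pi.sub_apply, zero_add] at hx
  linarith

/-- Elements of `H¹₀(0, H)` are primitives vanishing at both ends. -/
theorem IsH10.eq_primitive (hH : 0 < H) {u p : ℝ → ℝ} (hu : IsH10 (Ioo 0 H) u)
    (hp : HasWeakDirDeriv (Ioo 0 H) 1 u p) :
    IsL2 (Ioo 0 H) p ∧ u =ᵐ[volume.restrict (Ioo 0 H)] (fun x => ∫ t in 0..x, p t) ∧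
      ∫ t in 0..H, p t = 0 := by
  obtain ⟨hu2, φ, hφ, hlim, hder⟩ := hu
  obtain ⟨g, hg, hgL, hglim⟩ := hder 1
  have hgp : g =ᵐ[volume.restrict (Ioo 0 H)] p := hg.ae_unique isOpen_Ioo hp (ae_eq_refl u)
  have hpL : IsL2 (Ioo 0 H) p := MemLp.ae_eq hgp hgL
  have hpi := Lp.intervalIntegrable_of_restrict_Ioo hH.le hpL
  have hplim : Tendsto (fun n => eLpNorm (fun x => p x - fderiv ℝ (φ n) x 1) 2
      (volume.restrict (Ioo 0 H))) atTop (𝓝 0) := by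
    refine hglim.congr fun n => eLpNorm_congr_ae ?_
    filter_upwards [hgp] with x hx
    rw [hx]
  obtain ⟨a, ha⟩ := hp.exists_ae_eq_primitive hH hpi
  have h1L : MemLp (fun _ : ℝ => (1 : ℝ)) 2 (volume.restrict (Ioo 0 H)) := memLp_const 1
  have hxL : MemLp (fun x : ℝ => x) 2 (volume.restrict (Ioo 0 H)) :=
    MemLp.of_bound aestronglyMeasurable_id H (by
      filter_upwards [ae_restrict_mem measurableSet_Ioo] with x hx
      rw [Real.norm_of_nonneg hx.1.le]; exact hx.2.le)
  have hφL : ∀ n, MemLp (φ n) 2 (volume.restrict (Ioo 0 H)) := fun n => (hφ n).memLp 2 _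
  have hφ'L : ∀ n, MemLp (fun x => fderiv ℝ (φ n) x 1) 2 (volume.restrict (Ioo 0 H)) :=
    fun n => ((hφ n).fderiv_apply 1).memLp 2 _
  -- The derivatives of the approximating test functions have mean zero, and this passes to the L²
  -- limit.
  have hint0 : ∫ t in 0..H, p t = 0 := by
    have h1 := tendsto_integral_mul_const_of_eLpNorm_sub hpL h1L hφ'L hplim
    simp only [mul_one] at h1
    rw [← integral_Ioo_eq_intervalIntegral hH.le]
    refine tendsto_nhds_unique h1 (tendsto_const_nhds.congr fun n => ?_)
    rw [integral_Ioo_eq_intervalIntegral hH.le, (hφ n).eq_primitive, (hφ n).apply_right]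
  -- For a test function φ the integral of (xφ)' vanishes. In the limit the same holds for u, and
  -- inserting u = a + ∫₀ˣ p leaves a H = 0.
  have hint1 : (∫ x in Ioo 0 H, p x * x) + ∫ x in Ioo 0 H, u x * 1 = 0 := by
    have h1 := (tendsto_integral_mul_const_of_eLpNorm_sub hpL hxL hφ'L hplim).add
      (tendsto_integral_mul_const_of_eLpNorm_sub hu2 h1L hφL hlim)
    refine tendsto_nhds_unique h1 (tendsto_const_nhds.congr fun n => ?_)
    rw [integral_Ioo_eq_intervalIntegral hH.le, integral_Ioo_eq_intervalIntegral hH.le]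
    have h2 := integral_primitive_mul
      (((hφ n).fderiv_apply 1).1.continuous.intervalIntegrable (μ := volume) 0 H)
      (q := fun _ => (1 : ℝ)) (by simp) 0 0
    simp only [(hφ n).eq_primitive, zero_add, (hφ n).apply_right,
      intervalIntegral.integral_const, sub_zero, smul_eq_mul, mul_one] at h2
    simp only [mul_one]
    linarith
  have ha0 : a = 0 := by
    have h1 : ∫ x in Ioo 0 H, u x * 1 = ∫ x in 0..H, (a + ∫ t in 0..x, p t) * 1 := by
      rw [← integral_Ioo_eq_intervalIntegral hH.le]
      refine integral_congr_ae ?_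
      filter_upwards [ha] with x hx
      rw [hx]
    have h2 := integral_primitive_mul hpi (q := fun _ => (1 : ℝ)) (by simp) a 0
    rw [h1, h2, hint0, integral_Ioo_eq_intervalIntegral hH.le] at hint1
    simp only [intervalIntegral.integral_const, sub_zero, smul_eq_mul, mul_one, zero_add, mul_zero,
      add_zero] at hint1
    have : a * H = 0 := by linarith
    exact (mul_eq_zero.1 this).resolve_right hH.ne'
  refine ⟨hpL, ?_, hint0⟩
  filter_upwards [ha] with x hx
  rw [hx, ha0, zero_add]

/-- Test functions are dense in `L²(0, H)`. -/
theorem exists_testFn_eLpNorm_sub_le {p : ℝ → ℝ} (hp : IsL2 (Ioo 0 H) p) {ε : ℝ}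
    (hε : 0 < ε) : ∃ ψ, IsTestFn (Ioo 0 H) ψ ∧
      eLpNorm (fun x => p x - ψ x) 2 (volume.restrict (Ioo 0 H)) ≤ ENNReal.ofReal ε := by
  let S : Submodule ℝ (IntervalL2 H) :=
    Submodule.span ℝ {f | ∃ ψ, ∃ hψ : IsTestFn (Ioo 0 H) ψ, f = (hψ.memLp 2 (Ioo 0 H)).toLp ψ}
  have hS : ∀ f ∈ S, ∃ ψ, ∃ hψ : IsTestFn (Ioo 0 H) ψ, f = (hψ.memLp 2 (Ioo 0 H)).toLp ψ := by
    intro f hf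
    induction hf using Submodule.span_induction with
    | mem f hf => exact hf
    | zero =>
      have h0 : IsTestFn (Ioo 0 H) (fun _ : ℝ => (0 : ℝ)) := by
        refine ⟨contDiff_const, HasCompactSupport.zero, ?_⟩
        have : tsupport (fun _ : ℝ => (0 : ℝ)) = ∅ := tsupport_eq_empty_iff.2 rfl
        rw [this]; exact empty_subset _
      exact ⟨_, h0, (MemLp.toLp_zero (h0.memLp 2 (Ioo 0 H))).symm⟩
    | add f g _ _ h1 h2 =>
      obtain ⟨φ, hφ, rfl⟩ := h1
      obtain ⟨ψ, hψ, rfl⟩ := h2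
      refine ⟨_, hφ.sub (hψ.const_mul (-1)), ?_⟩
      rw [← MemLp.toLp_add]
      exact MemLp.toLp_congr _ _ (Eventually.of_forall fun x => by simp)
    | smul a f _ h1 =>
      obtain ⟨φ, hφ, rfl⟩ := h1
      exact ⟨_, hφ.const_mul a, (MemLp.toLp_const_smul a (hφ.memLp 2 (Ioo 0 H))).symm⟩
  -- Density follows because the orthogonal complement is trivial by the fundamental lemma.
  have hdense : S.topologicalClosure = ⊤ := by
    rw [Submodule.topologicalClosure_eq_top_iff, Submodule.eq_bot_iff]
    intro f hf
    have hfL : LocallyIntegrableOn f (Ioo 0 H) :=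
      IntegrableOn.locallyIntegrableOn ((Lp.memLp f).integrable one_le_two)
    have := ae_eq_zero_of_forall_testFn isOpen_Ioo hfL fun ψ hψ => by
      have h1 := (Submodule.mem_orthogonal' S f).1 hf _ (Submodule.subset_span ⟨ψ, hψ, rfl⟩)
      rw [L2.inner_def] at h1
      refine Eq.trans (integral_congr_ae ?_) h1
      filter_upwards [(hψ.memLp 2 (Ioo 0 H)).coeFn_toLp] with x hx
      rw [hx]
      simp [mul_comm]
    exact (Lp.eq_zero_iff_ae_eq_zero).2 this
  have hmem : hp.toLp p ∈ closure (S : Set (IntervalL2 H)) := by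
    rw [← Submodule.topologicalClosure_coe, hdense]; trivial
  obtain ⟨f, hf, hd⟩ := Metric.mem_closure_iff.1 hmem ε hε
  obtain ⟨ψ, hψ, rfl⟩ := hS f hf
  refine ⟨ψ, hψ, ?_⟩
  rw [Lp.dist_def, eLpNorm_congr_ae (g := fun x => p x - ψ x)] at hd
  · refine (ENNReal.le_ofReal_iff_toReal_le ?_ hε.le).2 hd.le
    exact (hp.sub (hψ.memLp 2 (Ioo 0 H))).2.ne
  · exact (hp.coeFn_toLp).sub (hψ.memLp 2 (Ioo 0 H)).coeFn_toLp

/-- Primitives of mean-free square integrable functions belong to `H¹₀(0, H)`. -/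
theorem isH10_primitive (hH : 0 < H) {p : ℝ → ℝ} (hp : IsL2 (Ioo 0 H) p)
    (hint : ∫ t in 0..H, p t = 0) : IsH10 (Ioo 0 H) (fun x => ∫ t in 0..x, p t) := by
  have hpi := Lp.intervalIntegrable_of_restrict_Ioo hH.le hp
  have h1L : MemLp (fun _ : ℝ => (1 : ℝ)) 2 (volume.restrict (Ioo 0 H)) := memLp_const 1
  have hPL : MemLp (fun x => ∫ t in 0..x, p t) 2 (volume.restrict (Ioo 0 H)) := by
    refine (Lp.memLp (volterra hH.le (hp.toLp p))).ae_eq ?_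
    filter_upwards [volterra_coe hH.le (hp.toLp p), ae_restrict_mem measurableSet_Ioo] with x h1 h2
    rw [h1]
    exact intervalIntegral_congr_of_ae_restrict hp.coeFn_toLp (Ioo_subset_Icc_self h2)
  have hch : ∀ n : ℕ, ∃ ψ, IsTestFn (Ioo 0 H) ψ ∧
      eLpNorm (fun x => p x - ψ x) 2 (volume.restrict (Ioo 0 H)) ≤
        ENNReal.ofReal (1 / ((n : ℝ) + 1)) :=
    fun n => exists_testFn_eLpNorm_sub_le hp (by positivity)
  choose ψ hψ hψn using hch
  have hψL : ∀ n, MemLp (ψ n) 2 (volume.restrict (Ioo 0 H)) := fun n => (hψ n).memLp 2 _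
  have hψlim : Tendsto (fun n => eLpNorm (fun x => p x - ψ n x) 2 (volume.restrict (Ioo 0 H)))
      atTop (𝓝 0) := by
    refine tendsto_of_tendsto_of_tendsto_of_le_of_le tendsto_const_nhds ?_ (fun n => zero_le)
      hψn
    have := ENNReal.tendsto_ofReal tendsto_one_div_add_atTop_nhds_zero_nat
    simpa using this
  obtain ⟨η, hη, hη1⟩ := exists_testFn_integral_eq_one hH
  have hηL : MemLp η 2 (volume.restrict (Ioo 0 H)) := hη.memLp 2 _
  set b : ℕ → ℝ := fun n => ∫ x in 0..H, ψ n x with hb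
  have hb0 : Tendsto b atTop (𝓝 0) := by
    have := tendsto_integral_mul_const_of_eLpNorm_sub hp h1L hψL hψlim
    simp only [mul_one] at this
    rw [integral_Ioo_eq_intervalIntegral hH.le, hint] at this
    exact this.congr fun n => integral_Ioo_eq_intervalIntegral hH.le _
  -- The means `b n` tend to ∫ p = 0, so removing them does not change the limit, and now the
  -- primitives of `q n` are test functions. They converge in L² because the Volterra operator is
  -- continuous.
  set q : ℕ → ℝ → ℝ := fun n x => ψ n x - b n * η x with hq
  have hqT : ∀ n, IsTestFn (Ioo 0 H) (q n) := fun n => (hψ n).sub (hη.const_mul (b n))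
  have hqint : ∀ n, ∫ x in 0..H, q n x = 0 := fun n => by
    simp only [hq]
    rw [intervalIntegral.integral_sub ((hψ n).1.continuous.intervalIntegrable _ _)
      ((hη.const_mul (b n)).1.continuous.intervalIntegrable _ _),
      intervalIntegral.integral_const_mul, hη1, mul_one, sub_self]
  have hqL : ∀ n, MemLp (q n) 2 (volume.restrict (Ioo 0 H)) := fun n => (hqT n).memLp 2 _
  have hqtoLp : Tendsto (fun n => (hqL n).toLp (q n)) atTop (𝓝 (hp.toLp p)) := by
    have h1 := (tendsto_toLp_of_eLpNorm_sub hp hψL hψlim).sub (hb0.smul_const (hηL.toLp η))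
    rw [zero_smul, sub_zero] at h1
    refine h1.congr fun n => ?_
    rw [← MemLp.toLp_const_smul, ← MemLp.toLp_sub]
    rfl
  have hqlim := tendsto_eLpNorm_sub_of_tendsto_toLp hp hqL hqtoLp
  have hT : ∀ n, IsTestFn (Ioo 0 H) (fun x => ∫ t in 0..x, q n t) := fun n =>
    (isTestFn_primitive hH (hqT n) (hqint n)).1
  have hTL : ∀ n, MemLp (fun x => ∫ t in 0..x, q n t) 2 (volume.restrict (Ioo 0 H)) :=
    fun n => (hT n).memLp 2 _
  have hvol : ∀ {f : ℝ → ℝ} (hf : MemLp f 2 (volume.restrict (Ioo 0 H)))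
      (hF : MemLp (fun x => ∫ t in 0..x, f t) 2 (volume.restrict (Ioo 0 H))),
      volterra hH.le (hf.toLp f) = hF.toLp _ := by
    intro f hf hF
    apply Lp.ext
    filter_upwards [volterra_coe hH.le (hf.toLp f), hF.coeFn_toLp,
      ae_restrict_mem measurableSet_Ioo] with x h1 h2 h3
    rw [h1, h2]
    exact intervalIntegral_congr_of_ae_restrict hf.coeFn_toLp (Ioo_subset_Icc_self h3)
  refine ⟨hPL, fun n x => ∫ t in 0..x, q n t, hT, ?_, fun v => ?_⟩
  · refine tendsto_eLpNorm_sub_of_tendsto_toLp hPL hTL ?_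
    have := ((volterra hH.le).continuous.tendsto _).comp hqtoLp
    rw [hvol hp hPL] at this
    exact this.congr fun n => hvol (hqL n) (hTL n)
  · have hw := (hasWeakDirDeriv_primitive hH.le hpi 0).smul_dir v
    simp only [zero_add, smul_eq_mul, mul_one] at hw
    have hvpL : MemLp (fun x => v * p x) 2 (volume.restrict (Ioo 0 H)) := hp.const_mul v
    refine ⟨fun x => v * p x, hw, hvpL, ?_⟩
    have hvqL : ∀ n, MemLp (fun x => v * q n x) 2 (volume.restrict (Ioo 0 H)) :=
      fun n => (hqL n).const_mul v
    have h1 := tendsto_eLpNorm_sub_of_tendsto_toLp hvpL hvqL (by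
      have e1 : v • hp.toLp p = hvpL.toLp _ := (MemLp.toLp_const_smul v hp).symm
      rw [← e1]
      exact (hqtoLp.const_smul v).congr fun n => (MemLp.toLp_const_smul v (hqL n)).symm)
    refine h1.congr fun n => ?_
    congr 1
    ext x
    have h2 := (isTestFn_primitive hH (hqT n) (hqint n)).2 x
    have h3 : fderiv ℝ (fun x => ∫ t in 0..x, q n t) x v = v * q n x := by
      rw [fderiv_eq_smul_deriv, ← fderiv_apply_one_eq_deriv, h2, smul_eq_mul]
    rw [h3]

end WeakDerivInterval

/-! ### The reduced operators -/

theorem HasWeakDirDeriv.const_mul {E : Type*} [NormedAddCommGroup E] [NormedSpace ℝ E]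
    [MeasureSpace E] {U : Set E} {u g : E → ℝ} {v : E} (h : HasWeakDirDeriv U v u g) (a : ℝ) :
    HasWeakDirDeriv U v (fun x => a * u x) (fun x => a * g x) := by
  refine ⟨h.1.smul a, h.2.1.smul a, fun φ hφ => ?_⟩
  simp only [mul_assoc]
  rw [integral_const_mul, integral_const_mul, h.2.2 φ hφ, mul_neg]

/-- `u` solves `u'' = Q u` on `(0, H)` with `u(0) = u(H) = 0`, and `p = u'`. -/
structure IsDirichletSolution (H : ℝ) (Q u p : ℝ → ℝ) : Prop where
  continuousOn : ContinuousOn p (Icc 0 H)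
  eq_primitive : ∀ x ∈ Icc 0 H, u x = ∫ t in 0..x, p t
  deriv_eq_primitive : ∀ x ∈ Icc 0 H, p x = p 0 + ∫ t in 0..x, Q t * u t
  apply_right : u H = 0

section Reduced

variable {H : ℝ} {c : ℝ → ℝ} {m : ℝ}

/-- A coefficient with positive essential lower bound `cm` and essential upper bound `C`. -/
structure IsBoundedCoeff (H : ℝ) (c : ℝ → ℝ) (cm C : ℝ) : Prop where
  aesm : AEStronglyMeasurable c (volume.restrict (Ioo 0 H))
  pos : 0 < cm
  le : ∀ᵐ y ∂(volume.restrict (Ioo 0 H)), cm ≤ c y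
  ge : ∀ᵐ y ∂(volume.restrict (Ioo 0 H)), c y ≤ C

variable {cm C : ℝ}

theorem IsBoundedCoeff.aesm_inv (hc : IsBoundedCoeff H c cm C) :
    AEStronglyMeasurable (fun y => (c y)⁻¹) (volume.restrict (Ioo 0 H)) :=
  hc.aesm.aemeasurable.inv.aestronglyMeasurable

theorem IsBoundedCoeff.norm_potential_le (hc : IsBoundedCoeff H c cm C) (l : ℝ) :
    ∀ᵐ y ∂(volume.restrict (Ioo 0 H)), ‖m ^ 2 - l / c y‖ ≤ m ^ 2 + |l| / cm := by
  filter_upwards [hc.le] with y hy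
  have hcy : 0 < c y := hc.pos.trans_le hy
  refine (norm_sub_le _ _).trans ?_
  rw [Real.norm_eq_abs, Real.norm_eq_abs, abs_of_nonneg (sq_nonneg m), abs_div, abs_of_pos hcy]
  gcongr
  exact hc.pos

theorem IsBoundedCoeff.aesm_potential (hc : IsBoundedCoeff H c cm C) (l : ℝ) :
    AEStronglyMeasurable (fun y => m ^ 2 - l / c y) (volume.restrict (Ioo 0 H)) :=
  aestronglyMeasurable_const.sub
    ((aestronglyMeasurable_const (b := l)).mul hc.aesm_inv)

theorem IsDirichletSolution.memLp (hH : 0 < H) {Q u p : ℝ → ℝ}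
    (h : IsDirichletSolution H Q u p) :
    IsL2 (Ioo 0 H) u ∧ IsL2 (Ioo 0 H) p ∧ ContinuousOn u (Icc 0 H) := by
  have hpi : IntervalIntegrable p volume 0 H := by
    apply ContinuousOn.intervalIntegrable; rw [uIcc_of_le hH.le]; exact h.continuousOn
  have huc : ContinuousOn u (Icc 0 H) := by
    have := continuousOn_primitive' hpi 0
    rw [uIcc_of_le hH.le] at this
    exact this.congr fun x hx => by simp [h.eq_primitive x hx]
  have key : ∀ f : ℝ → ℝ, ContinuousOn f (Icc 0 H) → IsL2 (Ioo 0 H) f := by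
    intro f hf
    obtain ⟨K, hK⟩ := isCompact_Icc.exists_bound_of_continuousOn hf
    refine MemLp.of_bound ((hf.mono Ioo_subset_Icc_self).aestronglyMeasurable measurableSet_Ioo)
      K ?_
    filter_upwards [ae_restrict_mem measurableSet_Ioo] with x hx
    exact hK x (Ioo_subset_Icc_self hx)
  exact ⟨key u huc, key p h.continuousOn, huc⟩

/-- The reduced eigenvalue problem is a two-point boundary value problem. -/
theorem isReducedEigenvalue_iff (hH : 0 < H) (hc : IsBoundedCoeff H c cm C) (l : ℝ) :
    IsReducedEigenvalue H c m l ↔ ∃ u p, IsDirichletSolution H (fun y => m ^ 2 - l / c y) u p ∧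
      ∃ x ∈ Icc 0 H, u x ≠ 0 := by
  constructor
  · rintro ⟨u, p, q, hu2, hu0, hne, hup, hpq, heq⟩
    obtain ⟨hpL, hu, hp0⟩ := hu0.eq_primitive hH hup
    have hpi := Lp.intervalIntegrable_of_restrict_Ioo hH.le hpL
    have hq : q =ᵐ[volume.restrict (Ioo 0 H)] fun y => (m ^ 2 - l / c y) * u y := by
      filter_upwards [heq, hc.le] with y h1 h2
      have hcy : 0 < c y := hc.pos.trans_le h2
      field_simp
      linarith
    have hqL : IsL2 (Ioo 0 H) q :=
      (memLp_bdd_mul (hc.aesm_potential l) (hc.norm_potential_le l) hu2.1).ae_eq hq.symm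
    have hqi := Lp.intervalIntegrable_of_restrict_Ioo hH.le hqL
    obtain ⟨a, ha⟩ := hpq.exists_ae_eq_primitive hH hqi
    have hpc : ∀ x ∈ Icc 0 H, ∫ t in 0..x, p t = ∫ t in 0..x, (a + ∫ s in 0..t, q s) :=
      fun x hx => intervalIntegral_congr_of_ae_restrict ha hx
    refine ⟨fun x => ∫ t in 0..x, p t, fun x => a + ∫ t in 0..x, q t,
      ⟨?_, hpc, fun x hx => ?_, hp0⟩, ?_⟩
    · have := continuousOn_primitive' hqi a
      rwa [uIcc_of_le hH.le] at this
    · simp only [intervalIntegral.integral_same, add_zero]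
      congr 1
      refine intervalIntegral_congr_of_ae_restrict ?_ hx
      filter_upwards [hq, hu] with y h1 h2
      rw [h1, h2]
    · by_contra! hz
      apply hne
      filter_upwards [hu, ae_restrict_mem measurableSet_Ioo] with y h1 h2
      rw [h1]
      exact hz y (Ioo_subset_Icc_self h2)
  · rintro ⟨u, p, hs, x₀, hx₀, hux₀⟩
    obtain ⟨huL, hpL, huc⟩ := hs.memLp hH
    have hpi := Lp.intervalIntegrable_of_restrict_Ioo hH.le hpL
    set q : ℝ → ℝ := fun y => (m ^ 2 - l / c y) * u y with hq
    have hqL : IsL2 (Ioo 0 H) q :=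
      memLp_bdd_mul (hc.aesm_potential l) (hc.norm_potential_le l) huL
    have hqi := Lp.intervalIntegrable_of_restrict_Ioo hH.le hqL
    have hue : (fun x => 0 + ∫ t in 0..x, p t) =ᵐ[volume.restrict (Ioo 0 H)] u := by
      filter_upwards [ae_restrict_mem measurableSet_Ioo] with x hx
      rw [hs.eq_primitive x (Ioo_subset_Icc_self hx), zero_add]
    have hpe : (fun x => p 0 + ∫ t in 0..x, q t) =ᵐ[volume.restrict (Ioo 0 H)] p := by
      filter_upwards [ae_restrict_mem measurableSet_Ioo] with x hx
      rw [hs.deriv_eq_primitive x (Ioo_subset_Icc_self hx)]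
    have hup : HasWeakDirDeriv (Ioo 0 H) 1 u p :=
      (hasWeakDirDeriv_primitive hH.le hpi 0).congr hue (ae_eq_refl p)
    have hpq : HasWeakDirDeriv (Ioo 0 H) 1 p q :=
      (hasWeakDirDeriv_primitive hH.le hqi (p 0)).congr hpe (ae_eq_refl q)
    have hu0 : IsH10 (Ioo 0 H) u := by
      have hz : ∫ t in 0..H, p t = 0 := by
        rw [← hs.eq_primitive H (right_mem_Icc.2 hH.le), hs.apply_right]
      obtain ⟨h1, φ, hφ, hlim, hder⟩ := isH10_primitive hH hpL hz
      have hue' : (fun x => ∫ t in 0..x, p t) =ᵐ[volume.restrict (Ioo 0 H)] u := by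
        simpa using hue
      refine ⟨huL, φ, hφ, hlim.congr fun n => eLpNorm_congr_ae ?_, fun v => ?_⟩
      · filter_upwards [hue'] with x hx
        rw [hx]
      · obtain ⟨g, h2, h3, h4⟩ := hder v
        exact ⟨g, h2.congr hue' (ae_eq_refl g), h3, h4⟩
    refine ⟨u, p, q, ⟨huL, fun v => ⟨fun x => v * p x, ?_, hpL.const_mul v, fun w =>
      ⟨fun x => w * (v * q x), ?_, (hqL.const_mul v).const_mul w⟩⟩⟩, hu0, ?_, hup, hpq, ?_⟩
    · simpa using hup.smul_dir v
    · simpa using (hpq.const_mul v).smul_dir w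
    · intro hz
      have hcl : ∀ x ∈ Ioo 0 H, u x = 0 := by
        rw [ae_restrict_iff' measurableSet_Ioo] at hz
        have := Measure.eqOn_Ioo_of_ae_eq (μ := volume) (a := 0) (b := H) (f := u)
          (g := fun _ => 0) ((ae_restrict_iff' measurableSet_Ioo).2 hz)
          (huc.mono Ioo_subset_Icc_self) continuousOn_const
        exact fun x hx => this hx
      rcases hx₀.1.eq_or_lt with h | h
      · apply hux₀
        rw [hs.eq_primitive x₀ hx₀, ← h, intervalIntegral.integral_same]
      rcases hx₀.2.eq_or_lt with h' | h'
      · exact hux₀ (by rw [h', hs.apply_right])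
      · exact hux₀ (hcl x₀ ⟨h, h'⟩)
    · filter_upwards [hc.le] with y h2
      have hcy : 0 < c y := hc.pos.trans_le h2
      simp only [hq]
      field_simp
      ring

/-- Solutions vanishing to first order at `0` vanish. -/
theorem IsDirichletSolution.eq_zero (hH : 0 < H) (hc : IsBoundedCoeff H c cm C) {l : ℝ}
    {u p : ℝ → ℝ} (h : IsDirichletSolution H (fun y => m ^ 2 - l / c y) u p) (h0 : p 0 = 0) :
    ∀ x ∈ Icc 0 H, u x = 0 := by
  refine eq_zero_of_primitive_system hH.le h.continuousOn h.eq_primitive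
    (fun x hx => by rw [h.deriv_eq_primitive x hx, h0, zero_add])
    ((ae_restrict_iff' measurableSet_Ioo).1 (hc.norm_potential_le (m := m) l)) ?_
  have := hc.pos
  positivity

/-- With a the ratio of initial slopes the combination vanishes to first order at 0, hence
everywhere; this gives simplicity of the eigenvalues. -/
theorem IsDirichletSolution.sub_smul (hH : 0 < H) (hc : IsBoundedCoeff H c cm C) {l : ℝ}
    {u p u' p' : ℝ → ℝ} (h : IsDirichletSolution H (fun y => m ^ 2 - l / c y) u p)
    (h' : IsDirichletSolution H (fun y => m ^ 2 - l / c y) u' p') (a : ℝ) :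
    IsDirichletSolution H (fun y => m ^ 2 - l / c y) (fun x => u x - a * u' x)
      (fun x => p x - a * p' x) := by
  have hii : ∀ {f : ℝ → ℝ} {x : ℝ}, x ∈ Icc 0 H → IsL2 (Ioo 0 H) f →
      IntervalIntegrable f volume 0 x := fun {f x} hx hf =>
    (Lp.intervalIntegrable_of_restrict_Ioo hH.le hf).mono_set (by
      rw [uIcc_of_le hx.1, uIcc_of_le hH.le]; exact Icc_subset_Icc_right hx.2)
  have hq : ∀ {v r : ℝ → ℝ}, IsDirichletSolution H (fun y => m ^ 2 - l / c y) v r →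
      IsL2 (Ioo 0 H) (fun y => (m ^ 2 - l / c y) * v y) := fun hv =>
    memLp_bdd_mul (hc.aesm_potential l) (hc.norm_potential_le l) (hv.memLp hH).1
  refine ⟨h.continuousOn.sub (continuousOn_const.mul h'.continuousOn), fun x hx => ?_,
    fun x hx => ?_, by rw [h.apply_right, h'.apply_right]; ring⟩
  · rw [intervalIntegral.integral_sub (hii hx (h.memLp hH).2.1)
      ((hii hx (h'.memLp hH).2.1).const_mul a), intervalIntegral.integral_const_mul,
      h.eq_primitive x hx, h'.eq_primitive x hx]
  · simp only [mul_sub, mul_left_comm _ a]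
    rw [intervalIntegral.integral_sub (hii hx (hq h)) ((hii hx (hq h')).const_mul a),
      intervalIntegral.integral_const_mul, h.deriv_eq_primitive x hx,
      h'.deriv_eq_primitive x hx]
    ring

/-- Fixed points of the Green operator equation are solutions of the boundary value problem. -/
theorem exists_isDirichletSolution_of_green (hH : 0 < H) {Q : ℝ → ℝ} {f g : IntervalL2 H}
    (hg : g =ᵐ[volume.restrict (Ioo 0 H)] fun y => -(Q y * f y)) (hf : green hH g = f) :
    ∃ u p, IsDirichletSolution H Q u p ∧ f =ᵐ[volume.restrict (Ioo 0 H)] u := by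
  have hgi := Lp.intervalIntegrable_of_restrict_Ioo hH.le (Lp.memLp g)
  have hfe := green_coe hH g
  rw [hf] at hfe
  refine ⟨_, fun t => greenSlope H g + ∫ s in 0..t, -g s, ⟨?_, fun x _ => rfl, fun x hx => ?_,
    integral_greenSlope_sub hH hgi⟩, hfe⟩
  · have := continuousOn_primitive' hgi.neg (greenSlope H g)
    rwa [uIcc_of_le hH.le] at this
  · simp only [intervalIntegral.integral_same, add_zero]
    congr 1
    refine intervalIntegral_congr_of_ae_restrict ?_ hx
    filter_upwards [hg, hfe] with y h1 h2
    rw [h1, neg_neg, h2]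

/-- Converse of `exists_isDirichletSolution_of_green`, by uniqueness for -u'' = g with zero boundary
values. -/
theorem IsDirichletSolution.green_eq (hH : 0 < H) {Q u p : ℝ → ℝ}
    (h : IsDirichletSolution H Q u p) {f g : IntervalL2 H}
    (hf : f =ᵐ[volume.restrict (Ioo 0 H)] u)
    (hg : g =ᵐ[volume.restrict (Ioo 0 H)] fun y => -(Q y * u y)) : green hH g = f := by
  have hcongr : ∀ x ∈ Icc 0 H, ∫ t in 0..x, (p 0 + ∫ s in 0..t, -(-(Q s * u s))) = u x := by
    intro x hx
    rw [h.eq_primitive x hx]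
    refine intervalIntegral.integral_congr fun t ht => ?_
    rw [uIcc_of_le hx.1] at ht
    simp only [neg_neg]
    rw [h.deriv_eq_primitive t ⟨ht.1, ht.2.trans hx.2⟩]
  apply Lp.ext
  filter_upwards [green_ae_eq hH hg ((hcongr H (right_mem_Icc.2 hH.le)).trans h.apply_right), hf,
    ae_restrict_mem measurableSet_Ioo] with x h1 h2 h3
  rw [h1, h2, hcongr x (Ioo_subset_Icc_self h3)]

end Reduced

/-! ### The compact inverse of the reduced operator and eigenvalue counting -/

section Counting

variable {H : ℝ} {c : ℝ → ℝ} {m : ℝ} {cm C : ℝ}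

theorem IsTestFn.deriv {φ : ℝ → ℝ} (hφ : IsTestFn (Ioo 0 H) φ) :
    IsTestFn (Ioo 0 H) (_root_.deriv φ) :=
  hφ.fderiv_apply 1

theorem IsTestFn.integral_deriv {φ : ℝ → ℝ} (hφ : IsTestFn (Ioo 0 H) φ) (x : ℝ) :
    ∫ t in 0..x, _root_.deriv φ t = φ x :=
  hφ.eq_primitive x

/-- The reduced operator has a compact positive inverse, up to a unitary transformation; its
eigenvalues are the reciprocals of the reduced eigenvalues and they are simple. -/
theorem exists_reduced_inverse (hH : 0 < H) (hc : IsBoundedCoeff H c cm C) (m : ℝ) :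
    ∃ K : IntervalL2 H →L[ℝ] IntervalL2 H, IsCompactOperator K ∧ K.IsSymmetric ∧
      (∀ x, 0 ≤ inner ℝ (K x) x) ∧
      (∀ l, IsReducedEigenvalue H c m l ↔
        0 < l ∧ Module.End.HasEigenvalue (K : Module.End ℝ (IntervalL2 H)) l⁻¹) ∧
      (∀ τ : ℝ, 0 < τ → ∀ x y, K x = τ • x → K y = τ • y → x ≠ 0 → ∃ a : ℝ, y = a • x) ∧
      ∀ (v : IntervalL2 H) (U : ℝ → ℝ), IsTestFn (Ioo 0 H) U →
        v =ᵐ[volume.restrict (Ioo 0 H)] (fun y => √(c y) * (m ^ 2 * U y - deriv (deriv U) y)) →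
        inner ℝ (K v) v = ∫ y in Ioo 0 H, U y * (m ^ 2 * U y - deriv (deriv U) y) := by
  -- K = D R D with D multiplication by c^{-1/2} and R = (m² - d²/dy²)⁻¹. The equation reads u = l R
  -- D² u, that is K w = l⁻¹ w for w = D u. The conjugation by D moves the weight c⁻¹ out of the
  -- inner product, so K is symmetric in plain L².
  set b : ℝ → ℝ := fun y => (√(c y))⁻¹ with hb
  have hbm : AEStronglyMeasurable b (volume.restrict (Ioo 0 H)) :=
    (Real.continuous_sqrt.measurable.comp_aemeasurable hc.aesm.aemeasurable).inv.aestronglyMeasurable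
  have hbC : ∀ᵐ y ∂(volume.restrict (Ioo 0 H)), ‖b y‖ ≤ (√cm)⁻¹ := by
    filter_upwards [hc.le] with y hy
    rw [Real.norm_of_nonneg (by positivity)]
    exact inv_anti₀ (Real.sqrt_pos.2 hc.pos) (Real.sqrt_le_sqrt hy)
  obtain ⟨D, hD, hDsym⟩ := exists_mulOperator hbm hbC
  have hDD : ∀ f, D (D f) =ᵐ[volume.restrict (Ioo 0 H)] fun y => (c y)⁻¹ * f y := by
    intro f
    filter_upwards [hD (D f), hD f, hc.le] with y h1 h2 h3
    rw [h1, h2, ← mul_assoc]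
    simp only [hb]
    rw [← mul_inv, Real.mul_self_sqrt (hc.pos.le.trans h3)]
  have hDinj : ∀ f, D f = 0 → f = 0 := by
    intro f hf
    rw [Lp.eq_zero_iff_ae_eq_zero]
    have h0 := (Lp.eq_zero_iff_ae_eq_zero (f := D f)).1 hf
    filter_upwards [h0, hD f, hc.le] with y h1 h2 h3
    rw [h1] at h2
    have : b y ≠ 0 := inv_ne_zero (Real.sqrt_ne_zero'.2 (hc.pos.trans_le h3))
    exact (mul_eq_zero.1 h2.symm).resolve_left this
  obtain ⟨R, hR, hRc, hRsym, hRpos⟩ := exists_resolvent (isCompactOperator_green hH)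
    (isSymmetric_green hH) (inner_green_self_nonneg hH) (sq_nonneg m)
  set K : IntervalL2 H →L[ℝ] IntervalL2 H := D ∘L R ∘L D with hK
  have hKa : ∀ x, K x = D (R (D x)) := fun x => rfl
  have hD' : ∀ x y, inner ℝ (D x) y = inner ℝ x (D y) := fun x y => hDsym x y
  have hR' : ∀ x y, inner ℝ (R x) y = inner ℝ x (R y) := fun x y => hRsym x y
  have hKpos : ∀ x, 0 ≤ inner ℝ (K x) x := fun x => by
    rw [hKa, hD']; exact hRpos _
  -- For f = R D x the eigenvalue relation gives D x = τ⁻¹ c⁻¹ f, so f satisfies m² f - f'' = τ⁻¹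
  -- c⁻¹ f.
  have hsol : ∀ (τ : ℝ) (x : IntervalL2 H), 0 < τ → K x = τ • x →
      ∃ u p, IsDirichletSolution H (fun y => m ^ 2 - τ⁻¹ / c y) u p ∧
        R (D x) =ᵐ[volume.restrict (Ioo 0 H)] u := by
    intro τ x hτ hx
    have h1 := (hR (D x) _).1 rfl
    have h2 : D x = τ⁻¹ • D (D (R (D x))) := by
      rw [← hKa, hx, map_smul, smul_smul, inv_mul_cancel₀ hτ.ne', one_smul]
    set f := R (D x) with hf
    have h3 : green hH (τ⁻¹ • D (D f) - m ^ 2 • f) = f := by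
      rw [← h2, map_sub, map_smul, ← h1, add_sub_cancel_right]
    refine exists_isDirichletSolution_of_green hH ?_ h3
    filter_upwards [Lp.coeFn_sub (τ⁻¹ • D (D f)) (m ^ 2 • f), Lp.coeFn_smul (τ⁻¹) (D (D f)),
      Lp.coeFn_smul (m ^ 2) f, hDD f] with y e1 e2 e3 e4
    rw [e1, Pi.sub_apply, e2, e3, Pi.smul_apply, Pi.smul_apply, e4]
    simp only [smul_eq_mul]
    ring
  have hne : ∀ (τ : ℝ) (x : IntervalL2 H), 0 < τ → K x = τ • x → x ≠ 0 → R (D x) ≠ 0 := by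
    intro τ x hτ hx hx0 h0
    rw [hKa, h0, map_zero] at hx
    exact (smul_ne_zero hτ.ne' hx0) hx.symm
  refine ⟨K, (hRc.comp_clm D).clm_comp D, fun x y => ?_, hKpos, fun l => ?_, ?_, ?_⟩
  · change inner ℝ (K x) y = inner ℝ x (K y)
    rw [hKa, hKa, hD', hR', hD']
  · rw [isReducedEigenvalue_iff hH hc]
    constructor
    · rintro ⟨u, p, hs, x₀, hx₀, hux₀⟩
      obtain ⟨huL, -, -⟩ := hs.memLp hH
      set f : IntervalL2 H := huL.toLp u with hf
      have hfu : f =ᵐ[volume.restrict (Ioo 0 H)] u := huL.coeFn_toLp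
      have h1 : green hH (l • D (D f) - m ^ 2 • f) = f := by
        refine hs.green_eq hH hfu ?_
        filter_upwards [Lp.coeFn_sub (l • D (D f)) (m ^ 2 • f), Lp.coeFn_smul l (D (D f)),
          Lp.coeFn_smul (m ^ 2) f, hDD f, hfu] with y e1 e2 e3 e4 e5
        rw [e1, Pi.sub_apply, e2, e3, Pi.smul_apply, Pi.smul_apply, e4, e5]
        simp only [smul_eq_mul]
        ring
      have h2 : R (l • D (D f)) = f := by
        rw [hR]
        rw [map_sub, map_smul (green hH) (m ^ 2)] at h1
        rw [← sub_eq_iff_eq_add.1 h1]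
      -- If u vanished almost everywhere, u' would be constant. Then u(H) = 0 forces u'(0) = 0, and
      -- uniqueness for the initial value problem makes u vanish at every point.
      have hf0 : f ≠ 0 := by
        intro h0
        have hp0 : p 0 = 0 := by
          have h3 : green hH (0 : IntervalL2 H) = 0 := map_zero _
          have hz : ∀ᵐ y ∂(volume.restrict (Ioo 0 H)), u y = 0 := by
            have := (Lp.eq_zero_iff_ae_eq_zero (f := f)).1 h0
            filter_upwards [this, hfu] with y e1 e2
            rw [← e2, e1]; rfl
          have hpz : ∀ x ∈ Icc 0 H, p x = p 0 := by
            intro x hx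
            rw [hs.deriv_eq_primitive x hx]
            have : ∫ t in 0..x, (m ^ 2 - l / c t) * u t = ∫ t in 0..x, (0 : ℝ) := by
              refine intervalIntegral_congr_of_ae_restrict ?_ hx
              filter_upwards [hz] with y hy
              rw [hy, mul_zero]
            rw [this, intervalIntegral.integral_zero, add_zero]
          have h4 : ∫ t in 0..H, p t = ∫ t in 0..H, p 0 :=
            intervalIntegral.integral_congr fun t ht => hpz t (by rwa [uIcc_of_le hH.le] at ht)
          rw [← hs.eq_primitive H (right_mem_Icc.2 hH.le), hs.apply_right,
            intervalIntegral.integral_const, sub_zero, smul_eq_mul] at h4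
          exact (mul_eq_zero.1 h4.symm).resolve_left hH.ne'
        exact hux₀ (hs.eq_zero hH hc hp0 x₀ hx₀)
      have hDf : D f ≠ 0 := fun h => hf0 (hDinj f h)
      have h3 : l • K (D f) = D f := by
        rw [hKa, ← map_smul, ← map_smul, h2]
      have hl0 : l ≠ 0 := by
        rintro rfl
        rw [zero_smul] at h3
        exact hDf h3.symm
      have h4 : K (D f) = l⁻¹ • D f := by
        rw [← h3, smul_smul, inv_mul_cancel₀ hl0, one_smul, h3]
      refine ⟨?_, Module.End.hasEigenvalue_of_hasEigenvector (x := D f)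
        ⟨Module.End.mem_eigenspace_iff.2 h4, hDf⟩⟩
      have h5 := hKpos (D f)
      rw [h4, real_inner_smul_left] at h5
      have h6 := nonneg_of_mul_nonneg_left h5 (real_inner_self_pos.2 hDf)
      exact lt_of_le_of_ne (inv_nonneg.1 h6) hl0.symm
    · rintro ⟨hl, hE⟩
      obtain ⟨x, hx⟩ := hE.exists_hasEigenvector
      have hx1 : K x = l⁻¹ • x := hx.apply_eq_smul
      obtain ⟨u, p, hs, hu⟩ := hsol _ x (inv_pos.2 hl) hx1
      rw [inv_inv] at hs
      refine ⟨u, p, hs, ?_⟩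
      by_contra! hz
      refine hne _ x (inv_pos.2 hl) hx1 hx.2 ?_
      rw [Lp.eq_zero_iff_ae_eq_zero]
      filter_upwards [hu, ae_restrict_mem measurableSet_Ioo] with y h1 h2
      rw [h1, hz y (Ioo_subset_Icc_self h2)]; rfl
  · intro τ hτ x y hx hy hx0
    obtain ⟨u, p, hs, hu⟩ := hsol τ x hτ hx
    obtain ⟨u', p', hs', hu'⟩ := hsol τ y hτ hy
    have hp0 : p 0 ≠ 0 := by
      intro h0
      have hz := hs.eq_zero hH hc h0
      refine hne τ x hτ hx hx0 ?_
      rw [Lp.eq_zero_iff_ae_eq_zero]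
      filter_upwards [hu, ae_restrict_mem measurableSet_Ioo] with y h1 h2
      rw [h1, hz y (Ioo_subset_Icc_self h2)]; rfl
    -- Two solutions with the same l differ by the ratio of their initial slopes.
    refine ⟨p' 0 / p 0, ?_⟩
    have hz := (hs'.sub_smul hH hc hs (p' 0 / p 0)).eq_zero hH hc (by field_simp; ring)
    have h1 : R (D y) = (p' 0 / p 0) • R (D x) := by
      apply Lp.ext
      filter_upwards [hu, hu', Lp.coeFn_smul (p' 0 / p 0) (R (D x)),
        ae_restrict_mem measurableSet_Ioo] with t e1 e2 e3 e4
      rw [e3, Pi.smul_apply, e1, e2, smul_eq_mul]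
      exact sub_eq_zero.1 (hz t (Ioo_subset_Icc_self e4))
    have h2 : τ • y = τ • ((p' 0 / p 0) • x) := by
      rw [← hy, hKa, h1, map_smul, ← hKa, hx, smul_comm]
    exact smul_right_injective _ hτ.ne' h2
  · intro v U hU hv
    set F : ℝ → ℝ := fun y => m ^ 2 * U y - deriv (deriv U) y with hF
    have hDv : D v =ᵐ[volume.restrict (Ioo 0 H)] F := by
      filter_upwards [hD v, hv, hc.le] with y h1 h2 h3
      rw [h1, h2, ← mul_assoc]
      simp only [hb]
      rw [inv_mul_cancel₀ (Real.sqrt_ne_zero'.2 (hc.pos.trans_le h3)), one_mul]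
    have hUL := hU.memLp 2 (Ioo 0 H)
    set f : IntervalL2 H := hUL.toLp U with hf
    have hfU : f =ᵐ[volume.restrict (Ioo 0 H)] U := hUL.coeFn_toLp
    have hint : ∀ x, ∫ t in 0..x, (0 + ∫ s in 0..t, -(-deriv (deriv U) s)) = U x := by
      intro x
      simp only [neg_neg, zero_add, hU.deriv.integral_deriv, hU.integral_deriv]
    -- D v = m² U - U'', so R D v = U and ⟨K v, v⟩ = ⟨R D v, D v⟩ = ∫ U (m² U - U''). The initial
    -- slope is 0 because U vanishes near 0.
    have h1 : green hH (D v - m ^ 2 • f) = f := by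
      have e : ((D v - m ^ 2 • f : IntervalL2 H) : ℝ → ℝ) =ᵐ[volume.restrict (Ioo 0 H)]
          fun y => -deriv (deriv U) y := by
        filter_upwards [Lp.coeFn_sub (D v) (m ^ 2 • f), Lp.coeFn_smul (m ^ 2) f, hDv, hfU]
          with y e1 e2 e3 e4
        rw [e1, Pi.sub_apply, e2, Pi.smul_apply, e3, e4, hF, smul_eq_mul]
        ring
      apply Lp.ext
      filter_upwards [green_ae_eq hH e (b := 0) ((hint H).trans hU.apply_right), hfU]
        with x e1 e2
      rw [e1, e2, hint]
    have h2 : R (D v) = f := by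
      rw [hR]
      rw [map_sub, map_smul (green hH) (m ^ 2)] at h1
      rw [← sub_eq_iff_eq_add.1 h1]
    rw [hKa, hD', h2, L2.inner_def]
    refine integral_congr_ae ?_
    filter_upwards [hDv, hfU] with y e1 e2
    rw [e1, e2, real_inner_comm]
    simp [hF]

/-- Counting reduced eigenvalues below a threshold with the help of test functions. -/
theorem finite_and_le_ncard_reducedEigenvalue (hH : 0 < H) (hc : IsBoundedCoeff H c cm C) (m : ℝ)
    {Λ : ℝ} (hΛ : 0 < Λ) {n : ℕ} (u : Fin n → ℝ → ℝ) (hu : ∀ i, IsTestFn (Ioo 0 H) (u i))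
    (hq : ∀ a : Fin n → ℝ, a ≠ 0 →
      Λ⁻¹ * (∫ y in Ioo 0 H, c y * (∑ i, a i * (m ^ 2 * u i y - deriv (deriv (u i)) y)) ^ 2) <
        ∫ y in Ioo 0 H, (∑ i, a i * u i y) *
          ∑ i, a i * (m ^ 2 * u i y - deriv (deriv (u i)) y)) :
    {l | IsReducedEigenvalue H c m l ∧ l < Λ}.Finite ∧
      n ≤ {l | IsReducedEigenvalue H c m l ∧ l < Λ}.ncard := by
  obtain ⟨K, hKc, hKsym, hKpos, hKE, hKsimple, hKtest⟩ := exists_reduced_inverse hH hc m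
  have himage : {l | IsReducedEigenvalue H c m l ∧ l < Λ} = (fun τ => τ⁻¹) ''
      {τ | Module.End.HasEigenvalue (K : Module.End ℝ (IntervalL2 H)) τ ∧ Λ⁻¹ < τ} := by
    ext l
    simp only [mem_ofPred_eq, mem_image, hKE]
    constructor
    · rintro ⟨⟨hl, hE⟩, hlΛ⟩
      exact ⟨l⁻¹, ⟨hE, inv_strictAnti₀ hl hlΛ⟩, inv_inv l⟩
    · rintro ⟨τ, ⟨hE, hτ⟩, rfl⟩
      have hτ0 : 0 < τ := (inv_pos.2 hΛ).trans hτ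
      refine ⟨⟨inv_pos.2 hτ0, by rwa [inv_inv]⟩, ?_⟩
      rw [← inv_inv Λ]
      exact inv_strictAnti₀ (inv_pos.2 hΛ) hτ
  have hfin := finite_setOf_hasEigenvalue_gt hKc hKsym (inv_pos.2 hΛ)
  rw [himage]
  refine ⟨hfin.image _, ?_⟩
  rw [ncard_image_of_injective _ inv_injective]
  have hsqm : AEStronglyMeasurable (fun y => √(c y)) (volume.restrict (Ioo 0 H)) :=
    (Real.continuous_sqrt.measurable.comp_aemeasurable hc.aesm.aemeasurable).aestronglyMeasurable
  have hsqC : ∀ᵐ y ∂(volume.restrict (Ioo 0 H)), ‖√(c y)‖ ≤ √C := by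
    filter_upwards [hc.ge] with y hy
    rw [Real.norm_of_nonneg (by positivity)]
    exact Real.sqrt_le_sqrt hy
  set F : Fin n → ℝ → ℝ := fun i y => m ^ 2 * u i y - deriv (deriv (u i)) y with hF
  have hFT : ∀ i, IsTestFn (Ioo 0 H) (F i) := fun i =>
    ((hu i).const_mul (m ^ 2)).sub (hu i).deriv.deriv
  have hvL : ∀ i, MemLp (fun y => √(c y) * F i y) 2 (volume.restrict (Ioo 0 H)) := fun i =>
    memLp_bdd_mul hsqm hsqC ((hFT i).memLp 2 _)
  -- The trial vectors are √c (m² u_i - u_i''). For their combinations `hq` is exactly the Rayleigh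
  -- inequality required of K.
  refine le_ncard_setOf_hasEigenvalue_gt hKc hKsym hKpos (inv_pos.2 hΛ)
    (fun τ hτ => hKsimple τ ((inv_pos.2 hΛ).trans hτ)) (fun i => (hvL i).toLp _) fun a ha => ?_
  set v : IntervalL2 H := ∑ i, a i • (hvL i).toLp _ with hv
  have hva : v =ᵐ[volume.restrict (Ioo 0 H)] fun y => √(c y) * ∑ i, a i * F i y := by
    have e1 : ∀ᵐ y ∂(volume.restrict (Ioo 0 H)), ∀ i,
        (a i • (hvL i).toLp (fun y => √(c y) * F i y) : IntervalL2 H) y =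
          a i * (√(c y) * F i y) := by
      rw [ae_all_iff]
      intro i
      filter_upwards [Lp.coeFn_smul (a i) ((hvL i).toLp _), (hvL i).coeFn_toLp] with y h1 h2
      rw [h1, Pi.smul_apply, h2, smul_eq_mul]
    filter_upwards [e1, Lp.coeFn_finsetSum Finset.univ
      (fun i => a i • (hvL i).toLp (fun y => √(c y) * F i y))] with y h1 h2
    rw [hv, h2, Finset.sum_apply, Finset.mul_sum]
    refine Finset.sum_congr rfl fun i _ => ?_
    rw [h1 i]; ring
  have hsum : ∀ (s : Finset (Fin n)), IsTestFn (Ioo 0 H) (fun y => ∑ i ∈ s, a i * u i y) := by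
    intro s
    induction s using Finset.induction_on with
    | empty =>
      refine ⟨by simpa using contDiff_const, by simp only [Finset.sum_empty]; exact HasCompactSupport.zero, ?_⟩
      have : tsupport (fun y => ∑ i ∈ (∅ : Finset (Fin n)), a i * u i y) = ∅ :=
        tsupport_eq_empty_iff.2 (by ext; simp)
      rw [this]; exact empty_subset _
    | insert i s his ih =>
      simp only [Finset.sum_insert his]
      have := ((hu i).const_mul (a i)).sub (ih.const_mul (-1))
      simpa using this
  have hU := hsum Finset.univ
  have hd1 : deriv (fun y => ∑ i, a i * u i y) = fun y => ∑ i, a i * deriv (u i) y := by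
    funext y
    rw [deriv_fun_sum fun i _ => ((hu i).1.differentiable (by simp) y).const_mul (a i)]
    exact Finset.sum_congr rfl fun i _ => deriv_const_mul _ ((hu i).1.differentiable (by simp) y)
  have hd2 : ∀ y, deriv (deriv (fun y => ∑ i, a i * u i y)) y =
      ∑ i, a i * deriv (deriv (u i)) y := by
    intro y
    rw [hd1, deriv_fun_sum fun i _ => ((hu i).deriv.1.differentiable (by simp) y).const_mul (a i)]
    exact Finset.sum_congr rfl fun i _ =>
      deriv_const_mul _ ((hu i).deriv.1.differentiable (by simp) y)
  have hFU : ∀ y, m ^ 2 * (∑ i, a i * u i y) - deriv (deriv (fun y => ∑ i, a i * u i y)) y =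
      ∑ i, a i * F i y := by
    intro y
    rw [hd2, Finset.mul_sum, ← Finset.sum_sub_distrib]
    refine Finset.sum_congr rfl fun i _ => ?_
    simp only [hF]; ring
  rw [hKtest v _ hU (by simpa only [hFU] using hva)]
  have hnorm : ‖v‖ ^ 2 = ∫ y in Ioo 0 H, c y * (∑ i, a i * F i y) ^ 2 := by
    rw [← real_inner_self_eq_norm_sq, L2.inner_def]
    refine integral_congr_ae ?_
    filter_upwards [hva, hc.le] with y h1 h2
    rw [h1]
    have := Real.sq_sqrt (hc.pos.le.trans h2)
    simp only [RCLike.inner_apply, conj_trivial]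
    linear_combination (∑ i, a i * F i y) ^ 2 * this
  rw [hnorm]
  simp only [hFU]
  exact hq a ha

end Counting

/-! ### Test functions concentrated in the well -/

section TestFunctions

variable {H : ℝ}

/-- Near a Lebesgue point where `g` is positive there is a test function `u` with `∫ g u² > 0`. -/
theorem exists_testFn_integral_mul_sq_pos {g : ℝ → ℝ} (hg : LocallyIntegrable g) {x : ℝ}
    (hx : x ∈ Ioo 0 H) (hgx : 0 < g x)
    (hleb : Tendsto (fun r => ⨍ y in Metric.closedBall x r, ‖g y - g x‖) (𝓝[>] 0) (𝓝 0))
    {V : Set ℝ} (hV : V ∈ 𝓝 x) :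
    ∃ u, IsTestFn (Ioo 0 H) u ∧ tsupport u ⊆ V ∧ 0 < ∫ y in Ioo 0 H, g y * u y ^ 2 := by
  have hW : V ∩ Ioo 0 H ∈ 𝓝 x := inter_mem hV (isOpen_Ioo.mem_nhds hx)
  obtain ⟨ε, hε, hεW⟩ := Metric.nhds_basis_closedBall.mem_iff.1 hW
  -- The bump f equals 1 on an interval of length r, so g(x) ∫ f² ≥ g(x) r. The ball has length 2r,
  -- so a mean oscillation below g(x)/4 costs less than g(x) r/2.
  have h1 : ∀ᶠ r in 𝓝[>] (0 : ℝ), ⨍ y in Metric.closedBall x r, ‖g y - g x‖ < g x / 4 :=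
    hleb.eventually_lt_const (by linarith)
  have h2 : ∀ᶠ r in 𝓝[>] (0 : ℝ), r ∈ Ioc 0 ε := Ioc_mem_nhdsGT hε
  obtain ⟨r, hr1, hr0, hrε⟩ := (h1.and h2).exists
  let f : ContDiffBump x := ⟨r / 2, r, by linarith, by linarith⟩
  have hts : tsupport f = Metric.closedBall x r := f.tsupport_eq
  have hsub : Metric.closedBall x r ⊆ V ∩ Ioo 0 H :=
    (Metric.closedBall_subset_closedBall hrε).trans hεW
  have hu : IsTestFn (Ioo 0 H) f :=
    ⟨f.contDiff, f.hasCompactSupport, by rw [hts]; exact hsub.trans inter_subset_right⟩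
  refine ⟨f, hu, by rw [hts]; exact hsub.trans inter_subset_left, ?_⟩
  set B := Metric.closedBall x r with hB
  have hBc : IsCompact B := isCompact_closedBall x r
  have hgB : IntegrableOn g B := hg.integrableOn_isCompact hBc
  have hfc : Continuous (fun y => f y ^ 2) := f.continuous.pow 2
  have hfB : IntegrableOn (fun y => f y ^ 2) B := hfc.continuousOn.integrableOn_compact hBc
  have hdB : IntegrableOn (fun y => ‖g y - g x‖) B :=
    (hgB.sub (integrableOn_const (hBc.measure_lt_top.ne))).norm
  have hvol : volume.real B = 2 * r := by
    rw [measureReal_def, hB, Real.volume_closedBall, ENNReal.toReal_ofReal (by linarith)]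
  have h3 : ∫ y in Ioo 0 H, g y * f y ^ 2 = ∫ y in B, g y * f y ^ 2 := by
    refine (setIntegral_eq_of_subset_of_forall_sdiff_eq_zero measurableSet_Ioo
      (hsub.trans inter_subset_right) fun y hy => ?_)
    have : f y = 0 := image_eq_zero_of_notMem_tsupport (by rw [hts]; exact hy.2)
    rw [this]; ring
  have h4 : ∫ y in B, (g x * f y ^ 2 - ‖g y - g x‖) ≤ ∫ y in B, g y * f y ^ 2 := by
    refine setIntegral_mono_on ((hfB.const_mul _).sub hdB)
      (hgB.mul_continuousOn hfc.continuousOn hBc) hBc.measurableSet fun y _ => ?_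
    have h5 : f y ^ 2 ≤ 1 := pow_le_one₀ f.nonneg f.le_one
    have h6 : 0 ≤ f y ^ 2 := sq_nonneg _
    have h7 := neg_abs_le (g y - g x)
    rw [Real.norm_eq_abs]
    nlinarith [abs_nonneg (g y - g x)]
  have h5 : r ≤ ∫ y in B, f y ^ 2 := by
    have hb : Metric.closedBall x (r / 2) ⊆ B := Metric.closedBall_subset_closedBall (by linarith)
    calc r = ∫ y in Metric.closedBall x (r / 2), (1 : ℝ) := by
          rw [setIntegral_const, measureReal_def, Real.volume_closedBall,
            ENNReal.toReal_ofReal (by linarith)]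
          simp only [smul_eq_mul, mul_one]; ring
      _ = ∫ y in Metric.closedBall x (r / 2), f y ^ 2 := by
          refine setIntegral_congr_fun measurableSet_closedBall fun y hy => ?_
          simp only [f.one_of_mem_closedBall hy, one_pow]
      _ ≤ ∫ y in B, f y ^ 2 :=
          setIntegral_mono_set hfB (Eventually.of_forall fun y => sq_nonneg _) hb.eventuallyLE
  have h6 : ∫ y in B, ‖g y - g x‖ < g x * r / 2 := by
    rw [setAverage_eq, hvol, smul_eq_mul, inv_mul_lt_iff₀ (by linarith)] at hr1
    linarith
  rw [integral_sub (hfB.const_mul _) hdB, integral_const_mul] at h4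
  rw [h3]
  nlinarith [mul_pos hgx hr0]

/-- Applied pointwise to functions with disjoint supports, it makes both quadratic forms diagonal in
the coefficients. -/
theorem sum_mul_sum_eq_of_orthogonal {ι : Type*} [Fintype ι] (f g : ι → ℝ)
    (h : ∀ i j, i ≠ j → f i * g j = 0) : (∑ i, f i) * ∑ i, g i = ∑ i, f i * g i := by
  rw [Finset.sum_mul_sum]
  exact Finset.sum_congr rfl fun i _ =>
    Finset.sum_eq_single i (fun j _ hj => h i j hj.symm) (by simp)

variable {c : ℝ → ℝ} {cm C : ℝ}

/-- The Rayleigh quotient of a test function on which `1 - c / c'` is positive in the mean falls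
below `c' s` for large `s`. -/
theorem eventually_testFn_rayleigh_lt (hc : IsBoundedCoeff H c cm C) {c' : ℝ} (hc' : 0 < c')
    {u : ℝ → ℝ} (hu : IsTestFn (Ioo 0 H) u)
    (hpos : 0 < ∫ y in Ioo 0 H, (1 - c y / c') * u y ^ 2) :
    ∀ᶠ s : ℝ in atTop, (c' * s)⁻¹ * (∫ y in Ioo 0 H, c y * (s * u y - deriv (deriv u) y) ^ 2) <
      ∫ y in Ioo 0 H, u y * (s * u y - deriv (deriv u) y) := by
  set w := deriv (deriv u) with hw
  have hwT : IsTestFn (Ioo 0 H) w := hu.deriv.deriv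
  have hcb : ∀ᵐ y ∂(volume.restrict (Ioo 0 H)), ‖c y‖ ≤ C := by
    filter_upwards [hc.le, hc.ge] with y h1 h2
    rwa [Real.norm_of_nonneg (hc.pos.le.trans h1)]
  have hi : ∀ {f g : ℝ → ℝ}, IsTestFn (Ioo 0 H) f → IsTestFn (Ioo 0 H) g →
      IntegrableOn (fun y => f y * g y) (Ioo 0 H) := fun hf hg =>
    (hf.memLp 2 (Ioo 0 H)).integrable_mul (hg.memLp 2 (Ioo 0 H))
  have hci : ∀ {f g : ℝ → ℝ}, IsTestFn (Ioo 0 H) f → IsTestFn (Ioo 0 H) g →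
      IntegrableOn (fun y => c y * (f y * g y)) (Ioo 0 H) := fun hf hg =>
    (hi hf hg).bdd_mul hc.aesm hcb
  set a1 := ∫ y in Ioo 0 H, u y * u y
  set a2 := ∫ y in Ioo 0 H, u y * w y
  set b1 := ∫ y in Ioo 0 H, c y * (u y * u y)
  set b2 := ∫ y in Ioo 0 H, c y * (u y * w y)
  set b3 := ∫ y in Ioo 0 H, c y * (w y * w y)
  have e1 : ∀ s : ℝ, ∫ y in Ioo 0 H, c y * (s * u y - w y) ^ 2 =
      s ^ 2 * b1 - 2 * s * b2 + b3 := by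
    intro s
    have : ∀ y, c y * (s * u y - w y) ^ 2 =
        s ^ 2 * (c y * (u y * u y)) - 2 * s * (c y * (u y * w y)) + c y * (w y * w y) :=
      fun y => by ring
    simp only [this]
    have hh : IntegrableOn (fun y => s ^ 2 * (c y * (u y * u y)) - 2 * s * (c y * (u y * w y)))
      (Ioo 0 H) := ((hci hu hu).const_mul _).sub ((hci hu hwT).const_mul _)
    rw [integral_add hh (hci hwT hwT),
      integral_sub ((hci hu hu).const_mul _) ((hci hu hwT).const_mul _), integral_const_mul,
      integral_const_mul]
  have e2 : ∀ s : ℝ, ∫ y in Ioo 0 H, u y * (s * u y - w y) = s * a1 - a2 := by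
    intro s
    have : ∀ y, u y * (s * u y - w y) = s * (u y * u y) - u y * w y := fun y => by ring
    simp only [this]
    rw [integral_sub ((hi hu hu).const_mul _) (hi hu hwT), integral_const_mul]
  have e3 : ∫ y in Ioo 0 H, (1 - c y / c') * u y ^ 2 = a1 - b1 / c' := by
    have : ∀ y, (1 - c y / c') * u y ^ 2 = u y * u y - c'⁻¹ * (c y * (u y * u y)) :=
      fun y => by field_simp
    simp only [this]
    rw [integral_sub (hi hu hu) ((hci hu hu).const_mul _), integral_const_mul]
    ring
  rw [e3] at hpos
  -- The right side minus the left side is s A - a2 + 2 b2/c' - b3/(c' s). As A > 0, the linear term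
  -- wins once s ≥ 1 and s A exceeds the sum of the absolute values of the other coefficients.
  set A := a1 - b1 / c' with hA
  filter_upwards [eventually_ge_atTop (1 : ℝ),
    eventually_gt_atTop ((|a2| + 2 * |b2| / c' + |b3| / c') / A)] with s hs1 hs2
  rw [e1, e2]
  rw [div_lt_iff₀ hpos] at hs2
  have hs0 : 0 < s := by linarith
  have e4 : (c' * s)⁻¹ * (s ^ 2 * b1 - 2 * s * b2 + b3) =
      s * (b1 / c') - 2 * b2 / c' + b3 / c' / s := by
    field_simp
  rw [e4]
  have k1 : b3 / c' / s ≤ |b3| / c' := by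
    rw [div_le_iff₀ hs0]
    have : b3 / c' ≤ |b3| / c' := by gcongr; exact le_abs_self _
    have : 0 ≤ |b3| / c' := by positivity
    nlinarith
  have k2 : -(2 * b2 / c') ≤ 2 * |b2| / c' := by
    rw [← neg_div]
    gcongr
    linarith [neg_abs_le b2]
  have k3 := le_abs_self a2
  have k4 : s * A = s * a1 - s * (b1 / c') := by rw [hA]; ring
  linarith

/-- For every `c'` above the essential infimum of `c`, the number of reduced eigenvalues below
`c' m²` is finite and exceeds any given bound when `m²` is large. -/
theorem eventually_finite_and_le_ncard (hH : 0 < H) (hc : IsBoundedCoeff H c cm C) {c' : ℝ}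
    (hc' : 0 < c') (hlow : ¬ ∀ᵐ y ∂(volume.restrict (Ioo 0 H)), c' ≤ c y) (n : ℕ) :
    ∀ᶠ s : ℝ in atTop, ∀ m : ℝ, m ^ 2 = s →
      {l | IsReducedEigenvalue H c m l ∧ l < c' * m ^ 2}.Finite ∧
        n ≤ {l | IsReducedEigenvalue H c m l ∧ l < c' * m ^ 2}.ncard := by
  set g : ℝ → ℝ := (Ioo 0 H).indicator (fun y => 1 - c y / c') with hg
  have hgI : IntegrableOn (fun y => 1 - c y / c') (Ioo 0 H) := by
    refine (integrableOn_const (by simp)).sub ?_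
    refine Integrable.div_const ?_ c'
    refine MemLp.integrable (q := ⊤) le_top ?_
    refine MemLp.of_bound hc.aesm C ?_
    filter_upwards [hc.le, hc.ge] with y h1 h2
    rwa [Real.norm_of_nonneg (hc.pos.le.trans h1)]
  have hgL : LocallyIntegrable g := by
    rw [← integrable_indicator_iff measurableSet_Ioo] at hgI
    exact hgI.locallyIntegrable
  set S := {x | x ∈ Ioo 0 H ∧ 0 < g x ∧
    Tendsto (fun r => ⨍ y in Metric.closedBall x r, ‖g y - g x‖) (𝓝[>] 0) (𝓝 0)} with hS
  -- Almost every point of (0, H) is a Lebesgue point of g. Were S finite, hence null, c' ≤ c would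
  -- hold almost everywhere.
  have hSinf : S.Infinite := by
    intro hfin
    apply hlow
    rw [ae_restrict_iff' measurableSet_Ioo]
    have hleb := IsUnifLocDoublingMeasure.ae_tendsto_average_norm_sub (μ := volume) hgL 1
    have hSn : ∀ᵐ x : ℝ, x ∉ S := hfin.measure_zero volume |> measure_eq_zero_iff_ae_notMem.1
    filter_upwards [hleb, hSn] with x h1 h2 hx
    by_contra hlt
    rw [not_le] at hlt
    refine h2 ⟨hx, ?_, ?_⟩
    · rw [hg, indicator_of_mem hx, sub_pos, div_lt_one hc']
      exact hlt
    · refine h1 (fun _ => x) (fun r => r) tendsto_id ?_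
      filter_upwards [self_mem_nhdsWithin] with r hr
      rw [one_mul]
      exact Metric.mem_closedBall_self (le_of_lt hr)
  obtain ⟨T, hTS, hTn⟩ := hSinf.exists_subset_card_eq n
  obtain ⟨V, hV, hVd⟩ := T.finite_toSet.t2_separation
  let e : Fin n ≃ T := (T.equivFinOfCardEq hTn).symm
  have hex : ∀ i : Fin n, ∃ u, IsTestFn (Ioo 0 H) u ∧ tsupport u ⊆ V (e i) ∧
      0 < ∫ y in Ioo 0 H, (1 - c y / c') * u y ^ 2 := by
    intro i
    obtain ⟨h1, h2, h3⟩ := hTS (e i).2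
    obtain ⟨u, hu, hs, hp⟩ := exists_testFn_integral_mul_sq_pos hgL h1 h2 h3
      ((hV (e i)).2.mem_nhds (hV (e i)).1)
    refine ⟨u, hu, hs, ?_⟩
    rwa [setIntegral_congr_fun (g := fun y => (1 - c y / c') * u y ^ 2) measurableSet_Ioo
      (fun y hy => by simp only [hg, indicator_of_mem hy])] at hp
  choose u hu hus hup using hex
  have hev : ∀ᶠ s : ℝ in atTop, ∀ i, (c' * s)⁻¹ *
      (∫ y in Ioo 0 H, c y * (s * u i y - deriv (deriv (u i)) y) ^ 2) <
      ∫ y in Ioo 0 H, u i y * (s * u i y - deriv (deriv (u i)) y) :=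
    eventually_all.2 fun i => eventually_testFn_rayleigh_lt hc hc' (hu i) (hup i)
  filter_upwards [hev, eventually_gt_atTop 0] with s hs hs0
  rintro m rfl
  refine finite_and_le_ncard_reducedEigenvalue hH hc m (mul_pos hc' hs0) u hu fun a ha => ?_
  set F : Fin n → ℝ → ℝ := fun i y => m ^ 2 * u i y - deriv (deriv (u i)) y with hF
  have hFT : ∀ i, IsTestFn (Ioo 0 H) (F i) := fun i =>
    ((hu i).const_mul (m ^ 2)).sub (hu i).deriv.deriv
  have hts : ∀ i y, y ∉ tsupport (u i) → u i y = 0 ∧ F i y = 0 := by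
    intro i y hy
    have h0 := image_eq_zero_of_notMem_tsupport hy
    have h1 : y ∉ tsupport (deriv (deriv (u i))) := fun h =>
      hy (((tsupport_deriv_subset).trans (tsupport_deriv_subset)) h)
    refine ⟨h0, ?_⟩
    simp only [hF]
    rw [h0, image_eq_zero_of_notMem_tsupport h1]
    ring
  have hdisj : ∀ i j, i ≠ j → ∀ y, y ∉ tsupport (u i) ∨ y ∉ tsupport (u j) := by
    intro i j hij y
    by_contra! h
    have hne : ((e i : T) : ℝ) ≠ e j := fun h' => hij (e.injective (Subtype.ext h'))
    exact Set.disjoint_left.1 (hVd (e i).2 (e j).2 hne) (hus i h.1) (hus j h.2)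
  have e1 : ∀ y, c y * (∑ i, a i * F i y) ^ 2 = ∑ i, a i ^ 2 * (c y * F i y ^ 2) := by
    intro y
    rw [sq, sum_mul_sum_eq_of_orthogonal, Finset.mul_sum]
    · exact Finset.sum_congr rfl fun i _ => by ring
    · intro i j hij
      rcases hdisj i j hij y with h | h <;> simp [(hts _ y h).2]
  have e2 : ∀ y, (∑ i, a i * u i y) * (∑ i, a i * F i y) = ∑ i, a i ^ 2 * (u i y * F i y) := by
    intro y
    rw [sum_mul_sum_eq_of_orthogonal]
    · exact Finset.sum_congr rfl fun i _ => by ring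
    · intro i j hij
      rcases hdisj i j hij y with h | h
      · simp [(hts _ y h).1]
      · simp [(hts _ y h).2]
  have hcb : ∀ᵐ y ∂(volume.restrict (Ioo 0 H)), ‖c y‖ ≤ C := by
    filter_upwards [hc.le, hc.ge] with y h1 h2
    rwa [Real.norm_of_nonneg (hc.pos.le.trans h1)]
  have hi1 : ∀ i, IntegrableOn (fun y => c y * F i y ^ 2) (Ioo 0 H) := fun i => by
    have h := ((hFT i).memLp 2 (Ioo 0 H)).integrable_mul ((hFT i).memLp 2 (Ioo 0 H))
    refine (Integrable.bdd_mul (f := c) h hc.aesm hcb).congr (Eventually.of_forall fun y => ?_)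
    simp only [Pi.mul_apply]; ring
  have hi2 : ∀ i, IntegrableOn (fun y => u i y * F i y) (Ioo 0 H) := fun i =>
    ((hu i).memLp 2 (Ioo 0 H)).integrable_mul ((hFT i).memLp 2 (Ioo 0 H))
  have hs' : ∀ i, (c' * m ^ 2)⁻¹ * (∫ y in Ioo 0 H, c y * F i y ^ 2) <
      ∫ y in Ioo 0 H, u i y * F i y := hs
  change (c' * m ^ 2)⁻¹ * (∫ y in Ioo 0 H, c y * (∑ i, a i * F i y) ^ 2) <
    ∫ y in Ioo 0 H, (∑ i, a i * u i y) * ∑ i, a i * F i y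
  simp only [e1, e2]
  rw [integral_finsetSum _ fun i _ => (hi1 i).const_mul _,
    integral_finsetSum _ fun i _ => (hi2 i).const_mul _, Finset.mul_sum]
  obtain ⟨i₀, hi₀⟩ := Function.ne_iff.1 ha
  -- Without cross terms the inequality is the sum of the n individual ones weighted by a_i², strict
  -- because some a_i is nonzero.
  refine Finset.sum_lt_sum (fun i _ => ?_) ⟨i₀, Finset.mem_univ _, ?_⟩
  · rw [integral_const_mul, integral_const_mul, mul_left_comm]
    exact mul_le_mul_of_nonneg_left (hs' i).le (sq_nonneg _)
  · rw [integral_const_mul, integral_const_mul, mul_left_comm]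
    have : a i₀ ≠ 0 := hi₀
    exact mul_lt_mul_of_pos_left (hs' i₀) (by positivity)

end TestFunctions

/-! ### The Dirichlet eigenvalues of the cross section tend to infinity -/

section CrossSection

variable {d : ℕ} {Ω : Set (EuclideanSpace ℝ (Fin d))}

/-- A Dirichlet eigenfunction is approximated in energy by test functions. -/
theorem SolvesDirichletEigen.exists_testFn (hΩ : IsOpen Ω) {t : ℝ}
    {u : EuclideanSpace ℝ (Fin d) → ℝ} (h : SolvesDirichletEigen Ω t u) :
    ∃ ψ : ℕ → EuclideanSpace ℝ (Fin d) → ℝ, (∀ n, IsTestFn Ω (ψ n)) ∧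
      Tendsto (fun n => eLpNorm (fun x => u x - ψ n x) 2 (volume.restrict Ω)) atTop (𝓝 0) ∧
      Tendsto (fun n => ∑ i, ∫ x in Ω, (fderiv ℝ (ψ n) x (EuclideanSpace.single i 1)) ^ 2) atTop
        (𝓝 (t * ∫ x in Ω, u x * u x)) := by
  obtain ⟨⟨huL, -⟩, ⟨-, ψ, hψ, hlim, hder⟩, g, h', hg, hh, heq⟩ := h
  refine ⟨ψ, hψ, hlim, ?_⟩
  choose G hGw hGL hGlim using fun i : Fin d => hder (EuclideanSpace.single i (1 : ℝ))
  have hGg : ∀ i, G i =ᵐ[volume.restrict Ω] g i := fun i =>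
    (hGw i).ae_unique hΩ (hg i) (ae_eq_refl u)
  have hψL : ∀ n, MemLp (ψ n) 2 (volume.restrict Ω) := fun n => (hψ n).memLp 2 Ω
  have hψ'L : ∀ i n, MemLp (fun x => fderiv ℝ (ψ n) x (EuclideanSpace.single i 1)) 2
      (volume.restrict Ω) := fun i n => ((hψ n).fderiv_apply _).memLp 2 Ω
  have h1 : Tendsto (fun n => ∑ i, ∫ x in Ω, (fderiv ℝ (ψ n) x (EuclideanSpace.single i 1)) ^ 2)
      atTop (𝓝 (∑ i, ∫ x in Ω, G i x * G i x)) := by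
    refine tendsto_finsetSum _ fun i _ => ?_
    simp only [sq]
    exact tendsto_integral_mul_of_eLpNorm_sub (hGL i) (hGL i) (hψ'L i) (hψ'L i) (hGlim i) (hGlim i)
  have h2 : Tendsto (fun n => ∑ i, ∫ x in Ω,
      fderiv ℝ (ψ n) x (EuclideanSpace.single i 1) * G i x)
      atTop (𝓝 (∑ i, ∫ x in Ω, G i x * G i x)) :=
    tendsto_finsetSum _ fun i _ =>
      tendsto_integral_mul_const_of_eLpNorm_sub (hGL i) (hGL i) (hψ'L i) (hGlim i)
  have h3 : Tendsto (fun n => t * ∫ x in Ω, ψ n x * u x) atTop (𝓝 (t * ∫ x in Ω, u x * u x)) :=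
    (tendsto_integral_mul_const_of_eLpNorm_sub huL huL hψL hlim).const_mul t
  -- This is the weak form of -Δu = t u tested with ψ_n. Its limit is the energy identity ∫ |∇u|² =
  -- t ∫ u².
  have h4 : ∀ n, ∑ i, ∫ x in Ω, fderiv ℝ (ψ n) x (EuclideanSpace.single i 1) * G i x =
      t * ∫ x in Ω, ψ n x * u x := by
    intro n
    have e1 : ∀ i, ∫ x in Ω, fderiv ℝ (ψ n) x (EuclideanSpace.single i 1) * G i x =
        - ∫ x in Ω, h' i x * ψ n x := by
      intro i
      rw [← (hh i).2.2 _ (hψ n)]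
      refine integral_congr_ae ?_
      filter_upwards [hGg i] with x hx
      rw [hx, mul_comm]
    simp only [e1]
    rw [Finset.sum_neg_distrib, ← integral_finsetSum _ fun i _ =>
      integrableOn_mul_testFn (hh i).2.1 (hψ n), ← integral_neg, ← integral_const_mul]
    refine integral_congr_ae ?_
    filter_upwards [heq] with x hx
    rw [← Finset.sum_mul, ← neg_mul, hx]
    ring
  have h5 := tendsto_nhds_unique (h3.congr fun n => (h4 n).symm) h2
  rw [h5]
  exact h1

open FourierTransform LineDeriv in
/-- The mass of a test function at high frequencies is controlled by its Dirichlet energy. -/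
theorem IsTestFn.integral_sq_le {ψ : EuclideanSpace ℝ (Fin d) → ℝ} (hψ : IsTestFn Ω ψ) {R : ℝ}
    (hR : 0 < R) :
    ∫ x in Ω, ψ x ^ 2 ≤
      (∫ ξ in Metric.closedBall 0 R, ‖𝓕 (fun x => (ψ x : ℂ)) ξ‖ ^ 2) +
      (R ^ 2)⁻¹ * ∑ i, ∫ x in Ω, (fderiv ℝ ψ x (EuclideanSpace.single i 1)) ^ 2 := by
  have hcs : HasCompactSupport (fun x => (ψ x : ℂ)) := hψ.2.1.comp_left (g := Complex.ofReal) rfl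
  have hcd : ContDiff ℝ ∞ (fun x => (ψ x : ℂ)) := Complex.ofRealCLM.contDiff.comp hψ.1
  set Ψ : SchwartzMap (EuclideanSpace ℝ (Fin d)) ℂ := hcs.toSchwartzMap hcd with hΨ
  have hΨa : ∀ x, Ψ x = (ψ x : ℂ) := fun x => rfl
  have hFa : ∀ ξ, 𝓕 (fun x => (ψ x : ℂ)) ξ = 𝓕 Ψ ξ := fun ξ => by
    rw [SchwartzMap.fourier_coe]; rfl
  have hΩ0 : ∀ {f : EuclideanSpace ℝ (Fin d) → ℝ}, IsTestFn Ω f →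
      ∫ x in Ω, f x ^ 2 = ∫ x, f x ^ 2 := fun hf =>
    setIntegral_eq_integral_of_forall_compl_eq_zero fun x hx => by
      rw [hf.eq_zero_of_notMem hx]; simp
  have hP : ∫ x in Ω, ψ x ^ 2 = ∫ ξ, ‖𝓕 Ψ ξ‖ ^ 2 := by
    rw [hΩ0 hψ, SchwartzMap.integral_norm_sq_fourier]
    refine integral_congr_ae (Eventually.of_forall fun x => ?_)
    simp [hΨa]
  have hm : ∀ (i : Fin d) (ξ : EuclideanSpace ℝ (Fin d)),
      ‖𝓕 (∂_{(EuclideanSpace.single i (1 : ℝ) : EuclideanSpace ℝ (Fin d))} Ψ) ξ‖ ^ 2 =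
        (2 * Real.pi * ξ i) ^ 2 * ‖𝓕 Ψ ξ‖ ^ 2 := by
    intro i ξ
    have hg : (fun y : EuclideanSpace ℝ (Fin d) =>
      inner ℝ y (EuclideanSpace.single i (1 : ℝ))).HasTemperateGrowth := by fun_prop
    rw [SchwartzMap.fourier_lineDerivOp_eq, _root_.smul_apply,
      SchwartzMap.smulLeftCLM_apply_apply hg, norm_smul, norm_smul,
      EuclideanSpace.inner_single_right]
    simp [mul_pow]
    ring
  have hI : ∀ Φ : SchwartzMap (EuclideanSpace ℝ (Fin d)) ℂ, Integrable (fun ξ => ‖Φ ξ‖ ^ 2) := by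
    intro Φ
    have := (Φ.memLp 2 volume).integrable_norm_pow (by norm_num)
    simpa using this
  have hD : ∀ i : Fin d, ∫ x in Ω, (fderiv ℝ ψ x (EuclideanSpace.single i 1)) ^ 2 =
      ∫ ξ, (2 * Real.pi * ξ i) ^ 2 * ‖𝓕 Ψ ξ‖ ^ 2 := by
    intro i
    have e1 := SchwartzMap.integral_norm_sq_fourier
      (∂_{(EuclideanSpace.single i (1 : ℝ) : EuclideanSpace ℝ (Fin d))} Ψ)
    rw [hΩ0 (hψ.fderiv_apply _)]
    have e2 : ∀ x, ‖(∂_{(EuclideanSpace.single i (1 : ℝ) : EuclideanSpace ℝ (Fin d))} Ψ) x‖ ^ 2 =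
        (fderiv ℝ ψ x (EuclideanSpace.single i 1)) ^ 2 := by
      intro x
      rw [SchwartzMap.lineDerivOp_apply_eq_fderiv]
      have : HasFDerivAt (⇑Ψ) (Complex.ofRealCLM.comp (fderiv ℝ ψ x)) x :=
        Complex.ofRealCLM.hasFDerivAt.comp x ((hψ.1.differentiable (by simp)) x).hasFDerivAt
      rw [this.fderiv]
      simp
    simp only [e2, hm] at e1
    exact e1.symm
  have hI2 : ∀ i : Fin d, Integrable (fun ξ : EuclideanSpace ℝ (Fin d) =>
      (2 * Real.pi * ξ i) ^ 2 * ‖𝓕 Ψ ξ‖ ^ 2) := by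
    intro i
    have := hI (𝓕 (∂_{(EuclideanSpace.single i (1 : ℝ) : EuclideanSpace ℝ (Fin d))} Ψ))
    simpa only [hm] using this
  have hI3 : Integrable (fun ξ : EuclideanSpace ℝ (Fin d) =>
      (R ^ 2)⁻¹ * ∑ i, (2 * Real.pi * ξ i) ^ 2 * ‖𝓕 Ψ ξ‖ ^ 2) :=
    (integrable_finsetSum _ fun i _ => hI2 i).const_mul _
  rw [hP, ← integral_add_compl (Metric.isClosed_closedBall (x := 0) (ε := R)).measurableSet
    (hI (𝓕 Ψ))]
  simp only [hFa, hD]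
  rw [← integral_finsetSum _ fun i _ => hI2 i, ← integral_const_mul]
  gcongr ?_ + ?_
  · exact le_refl _
  -- Outside the ball 1 ≤ R⁻² |ξ|² ≤ R⁻² Σ (2π ξ_i)², and by Plancherel the last sum is the Fourier
  -- multiplier of the energy.
  · refine (setIntegral_mono_on (hI _).integrableOn hI3.integrableOn
      Metric.isClosed_closedBall.measurableSet.compl fun ξ hξ => ?_).trans
      (setIntegral_le_integral hI3 (Eventually.of_forall fun ξ => by positivity))
    rw [← Finset.sum_mul, ← mul_assoc]
    refine le_mul_of_one_le_left (by positivity) ?_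
    rw [inv_mul_eq_div, one_le_div (by positivity)]
    have h1 : R ^ 2 ≤ ‖ξ‖ ^ 2 := by
      have : R < ‖ξ‖ := by simpa using hξ
      gcongr
    refine h1.trans ?_
    rw [EuclideanSpace.real_norm_sq_eq]
    refine Finset.sum_le_sum fun i _ => ?_
    have : (1 : ℝ) ≤ (2 * Real.pi) ^ 2 := one_le_pow₀ (by linarith [Real.pi_gt_three])
    rw [mul_pow]
    nlinarith [sq_nonneg (ξ i)]

end CrossSection

/-! ### Divergence of the Dirichlet eigenvalues -/

section CrossSectionLimit

variable {d : ℕ} {Ω : Set (EuclideanSpace ℝ (Fin d))}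

open FourierTransform in
-- Splitting the exponential expresses the transform by pairings with bounded continuous real
-- functions, so weak convergence in the real space L²(Ω) gives pointwise convergence of the
-- transforms when Ω is bounded.
theorem IsTestFn.fourier_eq {ψ : EuclideanSpace ℝ (Fin d) → ℝ} (hψ : IsTestFn Ω ψ)
    (ξ : EuclideanSpace ℝ (Fin d)) :
    𝓕 (fun x => (ψ x : ℂ)) ξ =
      ((∫ x in Ω, ψ x * Real.cos (2 * Real.pi * inner ℝ x ξ) : ℝ) : ℂ) -
        ((∫ x in Ω, ψ x * Real.sin (2 * Real.pi * inner ℝ x ξ) : ℝ) : ℂ) * Complex.I := by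
  have hΩ : ∀ f : EuclideanSpace ℝ (Fin d) → ℝ, ∫ x in Ω, ψ x * f x = ∫ x, ψ x * f x := fun f =>
    setIntegral_eq_integral_of_forall_compl_eq_zero fun x hx => by
      rw [hψ.eq_zero_of_notMem hx, zero_mul]
  have hi : ∀ f : EuclideanSpace ℝ (Fin d) → ℝ, Continuous f →
      Integrable (fun x => ((ψ x * f x : ℝ) : ℂ)) := fun f hf =>
    ((hψ.1.continuous.mul hf).integrable_of_hasCompactSupport hψ.2.1.mul_right).ofReal
  rw [hΩ, hΩ, ← integral_complex_ofReal, ← integral_complex_ofReal, ← integral_mul_const,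
    ← integral_sub (hi _ (by fun_prop)) ((hi _ (by fun_prop)).mul_const _), Real.fourier_eq']
  refine integral_congr_ae (Eventually.of_forall fun x => ?_)
  simp only [smul_eq_mul]
  rw [show ((-2 * Real.pi * inner ℝ x ξ : ℝ) : ℂ) * Complex.I =
    -((2 * Real.pi * inner ℝ x ξ : ℝ) : ℂ) * Complex.I by push_cast; ring,
    Complex.exp_mul_I, Complex.cos_neg, Complex.sin_neg]
  push_cast
  ring

open FourierTransform in
/-- The Dirichlet eigenvalues of a bounded open set tend to infinity. -/
theorem IsDirichletEigenSequence.tendsto_atTop (hΩ : IsOpen Ω) (hb : Bornology.IsBounded Ω)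
    {μ : ℕ → ℝ} {φ : ℕ → EuclideanSpace ℝ (Fin d) → ℝ} (h : IsDirichletEigenSequence Ω μ φ) :
    Tendsto (fun k => μ k ^ 2) atTop atTop := by
  by_contra hnot
  obtain ⟨M, hM⟩ : ∃ M, ∀ k, μ k ^ 2 ≤ M := by
    by_contra! hM
    exact hnot (tendsto_atTop_atTop_of_monotone h.mono fun b =>
      let ⟨a, ha⟩ := hM b; ⟨a, ha.le⟩)
  have hM0 : 0 ≤ M := (sq_nonneg _).trans (hM 0)
  have hfin : IsFiniteMeasure (volume.restrict Ω) :=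
    ⟨by rw [Measure.restrict_apply_univ]; exact hb.measure_lt_top⟩
  have hφL : ∀ k, MemLp (φ k) 2 (volume.restrict Ω) := fun k => (h.eigen k).1.1
  have hone : ∀ k, ∫ x in Ω, φ k x * φ k x = 1 := fun k => by simpa using h.orthonormal k k
  have hex : ∀ k : ℕ, ∃ ψ, IsTestFn Ω ψ ∧
      eLpNorm (fun x => φ k x - ψ x) 2 (volume.restrict Ω) ≤
        ENNReal.ofReal (1 / ((k : ℝ) + 1)) ∧
      ∑ i, ∫ x in Ω, (fderiv ℝ ψ x (EuclideanSpace.single i 1)) ^ 2 ≤ M + 1 := by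
    intro k
    obtain ⟨ψ, h1, h2, h3⟩ := (h.eigen k).exists_testFn hΩ
    rw [hone, mul_one] at h3
    have e1 : ∀ᶠ n in atTop, eLpNorm (fun x => φ k x - ψ n x) 2 (volume.restrict Ω) ≤
        ENNReal.ofReal (1 / ((k : ℝ) + 1)) :=
      h2.eventually_le_const (ENNReal.ofReal_pos.2 (by positivity))
    have e2 := h3.eventually_le_const (show μ k ^ 2 < M + 1 by linarith [hM k])
    obtain ⟨n, hn1, hn2⟩ := (e1.and e2).exists
    exact ⟨ψ n, h1 n, hn1, hn2⟩
  choose ψ hψ hψφ hψE using hex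
  have hψL : ∀ k, MemLp (ψ k) 2 (volume.restrict Ω) := fun k => (hψ k).memLp 2 Ω
  set e : ℕ → Lp ℝ 2 (volume.restrict Ω) := fun k => (hφL k).toLp (φ k) with he
  set w : ℕ → Lp ℝ 2 (volume.restrict Ω) := fun k => (hψL k).toLp (ψ k) with hw
  have hort : Orthonormal ℝ e := by
    rw [orthonormal_iff_ite]
    intro i j
    rw [he, inner_toLp_eq_integral]
    exact h.orthonormal i j
  have hew : ∀ k, ‖e k - w k‖ ≤ 1 / ((k : ℝ) + 1) := by
    intro k
    rw [he, hw]
    simp only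
    rw [← MemLp.toLp_sub, Lp.norm_toLp]
    exact ENNReal.toReal_le_of_le_ofReal (by positivity) (hψφ k)
  have hew0 : Tendsto (fun k => ‖e k - w k‖) atTop (𝓝 0) :=
    squeeze_zero (fun _ => norm_nonneg _) hew tendsto_one_div_add_atTop_nhds_zero_nat
  -- An orthonormal sequence is weakly null by Bessel's inequality, and w_k differs from it by a
  -- norm-null sequence.
  have hweak : ∀ f : Lp ℝ 2 (volume.restrict Ω), Tendsto (fun k => inner ℝ (w k) f) atTop (𝓝 0) := by
    intro f
    have h1 : Tendsto (fun k => inner ℝ (e k) f) atTop (𝓝 0) := by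
      have h2 := (hort.inner_products_summable (x := f)).tendsto_atTop_zero
      rw [tendsto_zero_iff_norm_tendsto_zero]
      have h3 := (Real.continuous_sqrt.tendsto 0).comp h2
      rw [Real.sqrt_zero] at h3
      refine h3.congr fun k => ?_
      simp only [Function.comp, Real.sqrt_sq (norm_nonneg _)]
    have h4 : Tendsto (fun k => inner ℝ (e k - w k) f) atTop (𝓝 0) := by
      refine squeeze_zero_norm (fun k => norm_inner_le_norm _ _) ?_
      simpa using hew0.mul_const ‖f‖
    have := h1.sub h4
    simpa [inner_sub_left] using this
  have hwn : ∀ k, ‖w k‖ ≤ 2 := by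
    intro k
    have h1 : ‖w k‖ ≤ ‖e k‖ + ‖e k - w k‖ := by
      have := norm_sub_le (e k) (e k - w k)
      simpa using this
    have h2 : 1 / ((k : ℝ) + 1) ≤ 1 := by
      rw [div_le_one (by positivity)]; linarith [(Nat.cast_nonneg k : (0 : ℝ) ≤ k)]
    have h3 := hort.1 k
    linarith [hew k]
  have hw1 : Tendsto (fun k => ∫ x in Ω, ψ k x ^ 2) atTop (𝓝 1) := by
    have h1 : Tendsto (fun k => ‖w k‖) atTop (𝓝 1) := by
      have h2 : ∀ k, ‖(‖w k‖ - 1)‖ ≤ ‖e k - w k‖ := fun k => by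
        rw [Real.norm_eq_abs, ← hort.1 k, abs_sub_comm]; exact abs_norm_sub_norm_le _ _
      have h3 := squeeze_zero_norm h2 hew0
      simpa using h3.add_const 1
    have h2 := h1.pow 2
    rw [one_pow] at h2
    refine h2.congr fun k => ?_
    rw [← real_inner_self_eq_norm_sq, hw, inner_toLp_eq_integral]
    simp only [sq]
  have hbL : ∀ f : EuclideanSpace ℝ (Fin d) → ℝ, Continuous f → (∀ x, ‖f x‖ ≤ 1) →
      MemLp f 2 (volume.restrict Ω) := fun f hf hf1 =>
    MemLp.of_bound hf.aestronglyMeasurable 1 (Eventually.of_forall hf1)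
  have htest0 : ∀ f : EuclideanSpace ℝ (Fin d) → ℝ, Continuous f → (∀ x, ‖f x‖ ≤ 1) →
      Tendsto (fun k => ∫ x in Ω, ψ k x * f x) atTop (𝓝 0) := by
    intro f hf hf1
    refine (hweak ((hbL f hf hf1).toLp f)).congr fun k => ?_
    rw [hw, inner_toLp_eq_integral]
  obtain ⟨B, hB⟩ : ∃ B : ℝ, ∀ f : EuclideanSpace ℝ (Fin d) → ℝ, Continuous f →
      (∀ x, ‖f x‖ ≤ 1) → ∀ k, ‖∫ x in Ω, ψ k x * f x‖ ≤ B := by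
    refine ⟨2 * ((measureUnivNNReal (volume.restrict Ω) : ℝ) ^ ((2 : ENNReal).toReal)⁻¹ * 1),
      fun f hf hf1 k => ?_⟩
    rw [← inner_toLp_eq_integral (hψL k) (hbL f hf hf1)]
    refine (norm_inner_le_norm _ _).trans (mul_le_mul (hwn k) ?_ (norm_nonneg _) two_pos.le)
    refine Lp.norm_le_of_ae_bound zero_le_one ?_
    filter_upwards [(hbL f hf hf1).coeFn_toLp] with x hx
    rw [hx]; exact hf1 x
  have hcos : ∀ ξ : EuclideanSpace ℝ (Fin d),
      Continuous fun x : EuclideanSpace ℝ (Fin d) => Real.cos (2 * Real.pi * inner ℝ x ξ) :=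
    fun ξ => by fun_prop
  have hsin : ∀ ξ : EuclideanSpace ℝ (Fin d),
      Continuous fun x : EuclideanSpace ℝ (Fin d) => Real.sin (2 * Real.pi * inner ℝ x ξ) :=
    fun ξ => by fun_prop
  have hF0 : ∀ ξ, Tendsto (fun k => ‖𝓕 (fun x => (ψ k x : ℂ)) ξ‖ ^ 2) atTop (𝓝 0) := by
    intro ξ
    have h1 := htest0 _ (hcos ξ) fun x => Real.abs_cos_le_one _
    have h2 := htest0 _ (hsin ξ) fun x => Real.abs_sin_le_one _
    have h3 := ((Complex.continuous_ofReal.tendsto 0).comp h1).sub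
      (((Complex.continuous_ofReal.tendsto 0).comp h2).mul_const Complex.I)
    have h4 := (h3.norm).pow 2
    simp only [Complex.ofReal_zero, zero_mul, sub_zero, norm_zero] at h4
    rw [zero_pow two_ne_zero] at h4
    refine h4.congr fun k => ?_
    rw [(hψ k).fourier_eq]
    rfl
  have hFB : ∀ k ξ, ‖𝓕 (fun x => (ψ k x : ℂ)) ξ‖ ^ 2 ≤ (B + B) ^ 2 := by
    intro k ξ
    have h1 := hB _ (hcos ξ) (fun x => Real.abs_cos_le_one _) k
    have h2 := hB _ (hsin ξ) (fun x => Real.abs_sin_le_one _) k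
    refine pow_le_pow_left₀ (norm_nonneg _) ?_ 2
    rw [(hψ k).fourier_eq]
    refine (norm_sub_le _ _).trans (add_le_add ?_ ?_)
    · rwa [Complex.norm_real]
    · rwa [norm_mul, Complex.norm_I, mul_one, Complex.norm_real]
  -- Chosen so that R⁻² (M + 1) = 1/2: this bounds the mass outside the ball, the energies being at
  -- most M + 1.
  set R : ℝ := √(2 * (M + 1)) with hR
  have hR0 : 0 < R := Real.sqrt_pos.2 (by linarith)
  have hDCT : Tendsto (fun k => ∫ ξ in Metric.closedBall (0 : EuclideanSpace ℝ (Fin d)) R,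
      ‖𝓕 (fun x => (ψ k x : ℂ)) ξ‖ ^ 2) atTop (𝓝 0) := by
    have h1 := tendsto_integral_of_dominated_convergence
      (μ := volume.restrict (Metric.closedBall (0 : EuclideanSpace ℝ (Fin d)) R))
      (F := fun k ξ => ‖𝓕 (fun x => (ψ k x : ℂ)) ξ‖ ^ 2) (f := fun _ => 0)
      (fun _ => (B + B) ^ 2) (fun k => ?_)
      (integrableOn_const (isCompact_closedBall _ _).measure_lt_top.ne)
      (fun k => Eventually.of_forall fun ξ => ?_) (Eventually.of_forall hF0)
    · simpa using h1
    · have hint : Integrable (fun x => (ψ k x : ℂ)) :=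
        ((hψ k).1.continuous.integrable_of_hasCompactSupport (hψ k).2.1).ofReal
      have hcont : Continuous (𝓕 (fun x => (ψ k x : ℂ))) :=
        VectorFourier.fourierIntegral_continuous Real.continuous_fourierChar
          (by exact continuous_inner) hint
      exact (hcont.norm.pow 2).aestronglyMeasurable
    · rw [Real.norm_of_nonneg (by positivity)]
      exact hFB k ξ
  have hle : ∀ k, ∫ x in Ω, ψ k x ^ 2 ≤
      (∫ ξ in Metric.closedBall (0 : EuclideanSpace ℝ (Fin d)) R,
        ‖𝓕 (fun x => (ψ k x : ℂ)) ξ‖ ^ 2) + 1 / 2 := by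
    intro k
    refine ((hψ k).integral_sq_le hR0).trans ?_
    gcongr
    rw [hR, Real.sq_sqrt (by linarith), inv_mul_le_iff₀ (by linarith)]
    linarith [hψE k]
  -- In the limit this reads 1 ≤ 0 + 1/2.
  have := le_of_tendsto_of_tendsto' hw1 (hDCT.add_const (1 / 2)) hle
  norm_num at this

end CrossSectionLimit

/-! ### The main theorem -/

/-- The reals are only conditionally complete, so `essInf` is a true essential lower bound only once
c is known to be essentially bounded below; the L^∞ norm supplies this bound and C. -/
theorem IsDiffusionCoeff.exists_isBoundedCoeff {H : ℝ} {c : ℝ → ℝ} (hc : IsDiffusionCoeff H c) :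
    ∃ C, IsBoundedCoeff H c (essInf c (volume.restrict (Ioo 0 H))) C := by
  set K := (eLpNormEssSup c (volume.restrict (Ioo 0 H))).toReal
  have hb : ∀ᵐ y ∂(volume.restrict (Ioo 0 H)), ‖c y‖ ≤ K := by
    have hfin : eLpNormEssSup c (volume.restrict (Ioo 0 H)) ≠ ⊤ := by
      have := hc.memLp_top.2
      rw [eLpNorm_exponent_top] at this
      exact this.ne
    filter_upwards [enorm_ae_le_eLpNormEssSup c (volume.restrict (Ioo 0 H))] with y hy
    have := ENNReal.toReal_mono hfin hy
    rwa [toReal_enorm] at this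
  refine ⟨K, hc.memLp_top.1, hc.essInf_pos, ae_essInf_le ?_, ?_⟩
  · refine ⟨-K, ?_⟩
    rw [eventually_map]
    filter_upwards [hb] with y hy
    exact (abs_le.1 hy).1
  · filter_upwards [hb] with y hy
    exact (abs_le.1 hy).2

/-- The essential infimum is the largest essential lower bound; for real values this needs the upper
bound on c and a nonzero measure. -/
theorem IsDiffusionCoeff.not_ae_le {H : ℝ} {c : ℝ → ℝ} (hH : 0 < H) (hc : IsDiffusionCoeff H c)
    {c' : ℝ} (hc' : essInf c (volume.restrict (Ioo 0 H)) < c') :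
    ¬ ∀ᵐ y ∂(volume.restrict (Ioo 0 H)), c' ≤ c y := by
  intro h
  obtain ⟨C, hC⟩ := hc.exists_isBoundedCoeff
  have hne : NeBot (ae (volume.restrict (Ioo 0 H))) := by
    rw [ae_neBot, Ne, Measure.restrict_eq_zero, Real.volume_Ioo]
    simpa using hH
  have hcob : IsCoboundedUnder (· ≥ ·) (ae (volume.restrict (Ioo 0 H))) c := by
    have hbu : IsBoundedUnder (· ≤ ·) (ae (volume.restrict (Ioo 0 H))) c := ⟨C, by
      rw [eventually_map]; exact hC.ge⟩
    exact hbu.isCoboundedUnder_ge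
  exact absurd (le_essInf_of_ae_le c' h hcob) (not_le.2 hc')

/-- `Set.ncard` is 0 on infinite sets, so divergence of the cardinalities also contains the
finiteness for large k. -/
theorem mainTheorem8 (d : ℕ) (hd : 1 ≤ d) (Ω : Set (EuclideanSpace ℝ (Fin d)))
    (hΩ : IsSmoothBoundedOpen Ω)
    (μ : ℕ → ℝ) (φ : ℕ → EuclideanSpace ℝ (Fin d) → ℝ)
    (hμ : IsDirichletEigenSequence Ω μ φ)
    (H : ℝ) (hH : 0 < H) (c : ℝ → ℝ) (hc : IsDiffusionCoeff H c)
    (α β c₁ : ℝ) (hwell : IsWell H c α β c₁) :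
    Tendsto (fun k => {l : ℝ | IsReducedEigenvalue H c (μ k) l ∧ 0 < xiSq c₁ (μ k) l}.ncard)
      atTop atTop ∧
    ∃ ε₀ : ℝ, 0 < ε₀ ∧ ∀ᶠ k in atTop,
      ∃ b : ℝ, IsLeast {l : ℝ | IsReducedEigenvalue H c (μ k) l} b ∧
        b < (c₁ - ε₀) * μ k ^ 2 := by
  obtain ⟨C, hC⟩ := hc.exists_isBoundedCoeff
  have hlim := hμ.tendsto_atTop hΩ.isOpen hΩ.isBounded
  have hc₁ : 0 < c₁ := hc.essInf_pos.trans hwell.essInf_lt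
  constructor
  · rw [tendsto_atTop]
    intro n
    filter_upwards [hlim.eventually (eventually_finite_and_le_ncard hH hC hc₁
      (hc.not_ae_le hH hwell.essInf_lt) n)] with k hk
    have hset : {l : ℝ | IsReducedEigenvalue H c (μ k) l ∧ 0 < xiSq c₁ (μ k) l} =
        {l : ℝ | IsReducedEigenvalue H c (μ k) l ∧ l < c₁ * μ k ^ 2} := by
      ext l
      refine and_congr_right fun _ => ?_
      rw [xiSq, mul_pos_iff_of_pos_left two_pos, sub_pos, div_lt_iff₀ hc₁, mul_comm c₁]
    rw [hset]
    exact (hk (μ k) rfl).2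
  -- With ε₀ = c₁ - c₂ the bound becomes c₂ μ_k². The eigenvalues below it form a finite nonempty
  -- set, whose minimum is the least eigenvalue because all others are at least c₂ μ_k².
  · obtain ⟨c₂, hc₂, hc₂₁⟩ := exists_between hwell.essInf_lt
    refine ⟨c₁ - c₂, sub_pos.2 hc₂₁, ?_⟩
    filter_upwards [hlim.eventually (eventually_finite_and_le_ncard hH hC
      (hc.essInf_pos.trans hc₂) (hc.not_ae_le hH hc₂) 1)] with k hk
    obtain ⟨hfin, hcard⟩ := hk (μ k) rfl
    have hne := (ncard_pos hfin).1 hcard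
    obtain ⟨b, hb, hmin⟩ := exists_min_image _ id hfin hne
    refine ⟨b, ⟨hb.1, fun l hl => ?_⟩, by rw [sub_sub_cancel]; exact hb.2⟩
    by_cases hlt : l < c₂ * μ k ^ 2
    · exact hmin l ⟨hl, hlt⟩
    · exact hb.2.le.trans (not_lt.1 hlt)
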